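/- Let $f:\mathbb{R}^n\to\mathbb{R}$ and $c:\mathbb{R}^n\to\mathbb{R}^m$; write $g=\nabla f$, $A(x)\in\mathbb{R}^{m\times n}$ for the Jacobian of $c$, $\mathcal{L}(x,\lambda)=f(x)+\lambda^\top c(x)$, $\|\cdot\|$ for the Euclidean norm and $\varphi(x,\mu)=f(x)+\mu\|c(x)\|_1$. A subscript $k$ means evaluation at $x_k$. **Algorithm (SCP).** Parameters: $\sigma_0\ge\sigma_{\min}>0$, $\mu_{-1}>0$, $0<\eta_1<\eta_2<1$, $\nu>1$, $\tau\in(0,1)$, $\theta\in(0,1]$, $\zeta\in(0,\theta)$, $1<\gamma_1<\gamma_2$, $\gamma_3\in(0,1]$, $\delta\in(0,1/6)$, $r_v\in[0,1-\tau)$, $r_\lambda,r_w\ge0$; stopping tolerances $s_g,s_c,s_H\ge0$. The algorithm stops at $x_k$ as soon as some $\lambda$ satisfies $\|\nabla_x\mathcal{L}(x_k,\lambda)\|\le s_g$, $\|c_k\|_1\le s_c$ and $d^\top\nabla^2_{xx}\mathcal{L}(x_k,\lambda)d\ge-s_H\|d\|^2$ whenever $A_kd=0$; in that case $\lambda_k$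 denotes such a multiplier. Otherwise iteration $k$ is as follows. 1. Normal step $v_k=\beta_kv_k^c$ with $v_k^c\in\mathcal{R}(A_k^\top)$ and $\|A_kv_k^c+c_k\|_1\le r_v\min\{\|c_k\|_1,\|v_k^c\|^3\}$; if $c_k\ne0$, then $\beta_k\in\big[\min\{1,\tfrac{\theta}{\|v_k^c\|\sqrt{\sigma_k}}\},\min\{1,\tfrac{1}{\|v_k^c\|\sqrt{\sigma_k}}\}\big]$; if $c_k=0$, then $v_k^c=0$ and $\beta_k=1$. 2. Multipliers $\lambda_k$ with $\|A_k(g_k+A_k^\top\lambda_k)\|\le r_\lambda\|v_k\|$; $H_k=\nabla^2f_k+\sum_i\lambda_k^i\nabla^2c_k^i$. 3. Let $P_k$ be the orthogonal projection onto $\mathcal{N}(A_k)$, $\tilde g_k=P_k^\top(g_k+H_kv_k)$, $\tilde H_k=P_k^\top H_kP_k$ and $m_k^U(u)=f_k+\tilde g_k^\top u+\tfrac12u^\top\tilde H_ku+\tfrac{\sigma_k}{3}\|P_ku\|^3$. The tangential step $u_k\in\mathcal{R}(P_k)$ satisfies $m_k^U(u_k)\le\min_{\alpha\ge0}m_k^U(-\alpha\tilde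 g_k)$, $\|\nabla m_k^U(u_k)\|\le\delta\sigma_k\|u_k\|^2$ and $\lambda_{\min}(\tilde H_k)\ge-\sigma_k\|u_k\|$. Put $d_k=v_k+u_k$. 4. $\mu_k=\nu\mu_k^c$ if $\mu_{k-1}<\mu_k^c$, and $\mu_k=\mu_{k-1}$ otherwise, where $\mu_k^c=0$ if $c_k=0$ and otherwise $$\mu_k^c=\frac{g_k^\top v_k+\frac12v_k^\top H_kv_k+\frac{\sigma_k}{3}(\|d_k\|^3-\|u_k\|^3)}{(1-r_v-\tau)\beta_k\|c_k\|_1}.$$ 5. Let $q_k(d)=f_k+g_k^\top d+\tfrac12d^\top H_kd+\tfrac{\sigma_k}{3}\|d\|^3+\mu_k\|c_k+A_kd\|_1$, $\Delta q_k=q_k(0)-q_k(d_k)$ and $\rho_k=[\varphi(x_k,\mu_k)-\varphi(x_k+d_k,\mu_k)]/\Delta q_k$. If $\rho_k<\eta_1$ and $\|v_k^c\|\le\zeta/\sqrt{\sigma_k}$, a correction $w_k\in\mathcal{R}(A_k^\top)$ with $\|A_kw_k+c(x_k+d_k)\|\le r_w\|d_k\|^3$ is computed, and the deciding ratio is $\rho=[\varphi(x_k,\mu_k)-\varphi(x_k+d_k+w_k,\mu_k)]/\Delta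 q_k$; otherwise it is $\rho=\rho_k$. The iteration is successful if $\rho\ge\eta_1$; then $x_{k+1}=x_k+d_k$, or $x_{k+1}=x_k+d_k+w_k$ if a correction was computed. Otherwise $x_{k+1}=x_k$. 6. $\sigma_{k+1}\in[\max\{\sigma_{\min},\gamma_3\sigma_k\},\sigma_k]$ if $\rho>\eta_2$, $\sigma_{k+1}=\sigma_k$ if $\eta_1\le\rho\le\eta_2$, and $\sigma_{k+1}\in[\gamma_1\sigma_k,\gamma_2\sigma_k]$ if $\rho<\eta_1$. **Assumptions.** $\mathcal{X}\subseteq\mathbb{R}^n$ is an open convex set containing all iterates $x_k$ and all trial points $x_k+d_k$ and (where a correction is computed) $x_k+d_k+w_k$. On $\mathcal{X}$, $f$ and $c$ are $C^2$; $f$, $\nabla f$, $\nabla^2f$, $c_i$, $\nabla c_i$, $\nabla^2c_i$ ($1\le i\le m$) are bounded and Lipschitz continuous with given constants, $|c_i|\le\kappa_{c_i}$ in particular; and $\sigma_{\min}(A(x))\ge\gamma_A>0$, i.e. $\|A(x)^\top y\|\ge\gamma_A\|y\|$ for all $y\in\mathbb{R}^m$. Further $f_{low}\le f(x_0)$ and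 $f_{low}\le f(x_k)$ at every successful iteration $k$. Put $\kappa_c=\sum_i\kappa_{c_i}$. **Theorem.** There are positive constants $\mu_{\max},\sigma^*,\alpha_1,\alpha_2,\alpha_3$, depending only on $m$, the parameters of the algorithm (not the stopping tolerances) and the bounds, Lipschitz constants and $\gamma_A$ above, such that, with $\sigma_{\max}=\max\{\sigma_0,\gamma_2\sigma^*\}$, every run satisfies $\mu_k\le\mu_{\max}$ and $\sigma_k\le\sigma_{\max}$ at all its iterations, and the following holds with $$\kappa_t=\frac{f(x_0)-f_{low}+2\kappa_c\mu_{\max}}{\eta_1\min\{\alpha_1,\alpha_2,\alpha_3\}},\qquad\tilde\kappa_t=(\log\gamma_1-\log\gamma_3)\kappa_t+\frac{\sigma_{\max}}{\sigma_0}.$$ For all $\epsilon_g,\epsilon_c\in(0,1)$ with $s_g\le\epsilon_g$ and $s_c\le\epsilon_c$, the run reaches a point $x_k$ with $\|\nabla_x\mathcal{L}(x_k,\lambda_k)\|\le\epsilon_g$ and $\|c_k\|_1\le\epsilon_c$ after at most $$\Big\lceil\kappa_t\max\{\epsilon_g^{-3/2},\epsilon_c^{-1}\}\Big\rceil+1$$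 successful iterations and at most $$\Big\lceil\frac{\tilde\kappa_t}{\log\gamma_1}\max\{\epsilon_g^{-3/2},\epsilon_c^{-1}\}\Big\rceil+1$$ iterations in total. -/

import Mathlib

open scoped NNReal

noncomputable section

namespace SCP

/-- Euclidean space of dimension `n`. -/
abbrev Vec (n : ℕ) := EuclideanSpace ℝ (Fin n)

/-- The l1 norm of a vector. -/
def l1 {m : ℕ} (y : Vec m) : ℝ := ∑ i, |y i|

/-- The Hessian of a real function, as a linear map. -/
def hess {n : ℕ} (f : Vec n → ℝ) (x : Vec n) : Vec n →L[ℝ] Vec n := fderiv ℝ (gradient f) x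

/-- The Jacobian `A(x)` of the constraints. -/
def jac {n m : ℕ} (c : Vec n → Vec m) (x : Vec n) : Vec n →L[ℝ] Vec m := fderiv ℝ c x

/-- The transpose `A(x)ᵀ` of the Jacobian. -/
def jacT {n m : ℕ} (c : Vec n → Vec m) (x : Vec n) : Vec m →L[ℝ] Vec n :=
  ContinuousLinearMap.adjoint (jac c x)

/-- The orthogonal projection onto the null space of `A(x)`. -/
def nullProj {n m : ℕ} (c : Vec n → Vec m) (x : Vec n) : Vec n →L[ℝ] Vec n :=
  (LinearMap.ker (jac c x).toLinearMap).starProjection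

/-- The Lagrangian `f(x) + yᵀ c(x)`. -/
def lagrangian {n m : ℕ} (f : Vec n → ℝ) (c : Vec n → Vec m) (x : Vec n) (y : Vec m) : ℝ :=
  f x + inner ℝ y (c x)

/-- The gradient of the Lagrangian with respect to `x`. -/
def gradLag {n m : ℕ} (f : Vec n → ℝ) (c : Vec n → Vec m) (x : Vec n) (y : Vec m) : Vec n :=
  gradient (fun z => lagrangian f c z y) x

/-- The Hessian of the Lagrangian, `∇²f(x) + ∑ᵢ yᵢ ∇²cᵢ(x)`. -/
def hessLag {n m : ℕ} (f : Vec n → ℝ) (c : Vec n → Vec m) (x : Vec n) (y : Vec m) :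
    Vec n →L[ℝ] Vec n :=
  hess f x + ∑ i, y i • hess (fun z => c z i) x

/-- `x` is an approximate second-order stationary point with multiplier `y`. -/
def IsSOSPWith {n m : ℕ} (f : Vec n → ℝ) (c : Vec n → Vec m) (εg εc εH : ℝ)
    (x : Vec n) (y : Vec m) : Prop :=
  ‖gradient f x + jacT c x y‖ ≤ εg ∧ l1 (c x) ≤ εc ∧
    ∀ d : Vec n, jac c x d = 0 → -εH * ‖d‖ ^ 2 ≤ inner ℝ d (hessLag f c x y d)

/-- The merit function `f(x) + μ ‖c(x)‖₁`. -/
def merit {n m : ℕ} (f : Vec n → ℝ) (c : Vec n → Vec m) (x : Vec n) (μ : ℝ) : ℝ :=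
  f x + μ * l1 (c x)

/-- The input parameters of the algorithm; `muInit` is the merit parameter `μ₋₁`. -/
structure Params where
  sigmaMin : ℝ
  sigma0 : ℝ
  muInit : ℝ
  η₁ : ℝ
  η₂ : ℝ
  ν : ℝ
  τ : ℝ
  θ : ℝ
  ζ : ℝ
  γ₁ : ℝ
  γ₂ : ℝ
  γ₃ : ℝ
  δ : ℝ
  rv : ℝ
  rl : ℝ
  rw : ℝ
  sigmaMin_pos : 0 < sigmaMin
  sigmaMin_le : sigmaMin ≤ sigma0
  muInit_pos : 0 < muInit
  η₁_pos : 0 < η₁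
  η₁_lt : η₁ < η₂
  η₂_lt : η₂ < 1
  ν_gt : 1 < ν
  τ_pos : 0 < τ
  τ_lt : τ < 1
  θ_pos : 0 < θ
  θ_le : θ ≤ 1
  ζ_pos : 0 < ζ
  ζ_lt : ζ < θ
  γ₁_gt : 1 < γ₁
  γ₁_lt : γ₁ < γ₂
  γ₃_pos : 0 < γ₃
  γ₃_le : γ₃ ≤ 1
  δ_pos : 0 < δ
  δ_lt : δ < 1 / 6
  rv_nonneg : 0 ≤ rv
  rv_lt : rv < 1 - τ
  rl_nonneg : 0 ≤ rl
  rw_nonneg : 0 ≤ rw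

/-- The quantities produced by an execution. Iteration `k` is performed when `k < N`; `N = ⊤` means
that the execution never stops, and a finite `N` is the index of the point at which it stops.
Entries with an index beyond `N` are meaningless, and `w k` is meaningful only if a correction step
is computed at iteration `k`. -/
structure Trace (n m : ℕ) where
  N : ℕ∞
  /-- iterates -/
  x : ℕ → Vec n
  /-- dual variables -/
  lam : ℕ → Vec m
  /-- normal steps before scaling by `β` -/
  vc : ℕ → Vec n
  /-- tangential steps -/
  u : ℕ → Vec n
  /-- correction steps -/
  w : ℕ → Vec n
  /-- feasibility-control parameters -/
  β : ℕ → ℝ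
  /-- cubic regularization parameters -/
  σ : ℕ → ℝ
  /-- merit parameters -/
  μ : ℕ → ℝ

namespace Trace

variable {n m : ℕ}

/-- The normal step. -/
def v (t : Trace n m) (k : ℕ) : Vec n := t.β k • t.vc k

/-- The trial step. -/
def d (t : Trace n m) (k : ℕ) : Vec n := t.v k + t.u k

/-- The Hessian of the Lagrangian at iteration `k`. -/
def H (t : Trace n m) (f : Vec n → ℝ) (c : Vec n → Vec m) (k : ℕ) : Vec n →L[ℝ] Vec n :=
  hessLag f c (t.x k) (t.lam k)

/-- The reduced gradient `Pᵀ (g + H v)`; the projection `P` is symmetric. -/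
def gTilde (t : Trace n m) (f : Vec n → ℝ) (c : Vec n → Vec m) (k : ℕ) : Vec n :=
  nullProj c (t.x k) (gradient f (t.x k) + t.H f c k (t.v k))

/-- The reduced Hessian `Pᵀ H P`. -/
def HTilde (t : Trace n m) (f : Vec n → ℝ) (c : Vec n → Vec m) (k : ℕ) : Vec n →L[ℝ] Vec n :=
  nullProj c (t.x k) ∘L t.H f c k ∘L nullProj c (t.x k)

/-- The reduced cubic model. -/
def mU (t : Trace n m) (f : Vec n → ℝ) (c : Vec n → Vec m) (k : ℕ) (y : Vec n) : ℝ :=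
  f (t.x k) + inner ℝ (t.gTilde f c k) y + 1 / 2 * inner ℝ y (t.HTilde f c k y)
    + t.σ k / 3 * ‖nullProj c (t.x k) y‖ ^ 3

/-- The predicted reduction of the reduced cubic model. -/
def deltaMU (t : Trace n m) (f : Vec n → ℝ) (c : Vec n → Vec m) (k : ℕ) (y : Vec n) : ℝ :=
  t.mU f c k 0 - t.mU f c k y

/-- The requirements on the tangential step: it lies in the range of `P`, decreases the reduced
model at least as much as the Cauchy step, makes the gradient of the reduced model small, and
dominates the negative curvature of the reduced Hessian. -/
structure Oracle (t : Trace n m) (p : Params) (f : Vec n → ℝ) (c : Vec n → Vec m) (k : ℕ) :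
    Prop where
  mem_range : t.u k ∈ LinearMap.range (nullProj c (t.x k)).toLinearMap
  cauchy : ∃ α : ℝ, 0 ≤ α ∧
    IsMinOn (fun a : ℝ => t.mU f c k (-(a • t.gTilde f c k))) (Set.Ici 0) α ∧
    t.deltaMU f c k (-(α • t.gTilde f c k)) ≤ t.deltaMU f c k (t.u k)
  gradient_le : ‖gradient (t.mU f c k) (t.u k)‖ ≤ p.δ * t.σ k * ‖t.u k‖ ^ 2
  curvature : ∀ e : ℝ, Module.End.HasEigenvalue (t.HTilde f c k).toLinearMap e →
    -(t.σ k * ‖t.u k‖) ≤ e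

/-- The requirements on the normal step. -/
structure NormalStep (t : Trace n m) (p : Params) (c : Vec n → Vec m) (k : ℕ) : Prop where
  mem_range : t.vc k ∈ LinearMap.range (jacT c (t.x k)).toLinearMap
  residual : l1 (jac c (t.x k) (t.vc k) + c (t.x k))
    ≤ p.rv * min (l1 (c (t.x k))) (‖t.vc k‖ ^ 3)
  feasible : c (t.x k) = 0 → t.vc k = 0 ∧ t.β k = 1
  beta_mem : c (t.x k) ≠ 0 → t.β k ∈ Set.Icc
    (min 1 (p.θ / (‖t.vc k‖ * √(t.σ k)))) (min 1 (1 / (‖t.vc k‖ * √(t.σ k))))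

/-- The previous merit parameter `μ_{k-1}`. -/
def prevMu (t : Trace n m) (p : Params) (k : ℕ) : ℝ := if k = 0 then p.muInit else t.μ (k - 1)

open Classical in
/-- The trial merit parameter. -/
def muC (t : Trace n m) (p : Params) (f : Vec n → ℝ) (c : Vec n → Vec m) (k : ℕ) : ℝ :=
  if l1 (c (t.x k)) = 0 then 0 else
    (inner ℝ (gradient f (t.x k)) (t.v k) + 1 / 2 * inner ℝ (t.v k) (t.H f c k (t.v k))
      + t.σ k / 3 * (‖t.d k‖ ^ 3 - ‖t.u k‖ ^ 3))
      / ((1 - p.rv - p.τ) * t.β k * l1 (c (t.x k)))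

/-- The cubic model of the merit function. -/
def q (t : Trace n m) (f : Vec n → ℝ) (c : Vec n → Vec m) (k : ℕ) (y : Vec n) : ℝ :=
  f (t.x k) + inner ℝ (gradient f (t.x k)) y + 1 / 2 * inner ℝ y (t.H f c k y)
    + t.σ k / 3 * ‖y‖ ^ 3 + t.μ k * l1 (c (t.x k) + jac c (t.x k) y)

/-- The predicted reduction of the merit function. -/
def deltaQ (t : Trace n m) (f : Vec n → ℝ) (c : Vec n → Vec m) (k : ℕ) : ℝ :=
  t.q f c k 0 - t.q f c k (t.d k)

/-- Actual over predicted reduction for the step `d`. -/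
def rho (t : Trace n m) (f : Vec n → ℝ) (c : Vec n → Vec m) (k : ℕ) : ℝ :=
  (merit f c (t.x k) (t.μ k) - merit f c (t.x k + t.d k) (t.μ k)) / t.deltaQ f c k

/-- Actual over predicted reduction for the corrected step `d + w`. -/
def rhoCorr (t : Trace n m) (f : Vec n → ℝ) (c : Vec n → Vec m) (k : ℕ) : ℝ :=
  (merit f c (t.x k) (t.μ k) - merit f c (t.x k + t.d k + t.w k) (t.μ k)) / t.deltaQ f c k

/-- A correction step is computed at iteration `k`. -/
def Corrects (t : Trace n m) (p : Params) (f : Vec n → ℝ) (c : Vec n → Vec m) (k : ℕ) : Prop :=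
  t.rho f c k < p.η₁ ∧ ‖t.vc k‖ ≤ p.ζ / √(t.σ k)

open Classical in
/-- The ratio that decides about iteration `k`. -/
def ratio (t : Trace n m) (p : Params) (f : Vec n → ℝ) (c : Vec n → Vec m) (k : ℕ) : ℝ :=
  if t.Corrects p f c k then t.rhoCorr f c k else t.rho f c k

/-- Iteration `k` is successful (this includes very successful iterations). -/
def Successful (t : Trace n m) (p : Params) (f : Vec n → ℝ) (c : Vec n → Vec m) (k : ℕ) : Prop :=
  p.η₁ ≤ t.ratio p f c k

open Classical in
/-- Iteration `k` obeys the rules of the algorithm. -/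
structure Step (t : Trace n m) (p : Params) (f : Vec n → ℝ) (c : Vec n → Vec m) (k : ℕ) :
    Prop where
  normal : t.NormalStep p c k
  dual : ‖jac c (t.x k) (gradient f (t.x k) + jacT c (t.x k) (t.lam k))‖ ≤ p.rl * ‖t.v k‖
  tangential : t.Oracle p f c k
  mu_update : t.μ k = if t.prevMu p k < t.muC p f c k then p.ν * t.muC p f c k else t.prevMu p k
  correction : t.Corrects p f c k →
    t.w k ∈ LinearMap.range (jacT c (t.x k)).toLinearMap ∧
    ‖jac c (t.x k) (t.w k) + c (t.x k + t.d k)‖ ≤ p.rw * ‖t.d k‖ ^ 3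
  x_update : t.x (k + 1) =
    if t.Successful p f c k then
      (if t.Corrects p f c k then t.x k + t.d k + t.w k else t.x k + t.d k)
    else t.x k
  sigma_very_successful : p.η₂ < t.ratio p f c k →
    t.σ (k + 1) ∈ Set.Icc (max p.sigmaMin (p.γ₃ * t.σ k)) (t.σ k)
  sigma_successful : p.η₁ ≤ t.ratio p f c k → t.ratio p f c k ≤ p.η₂ → t.σ (k + 1) = t.σ k
  sigma_unsuccessful : t.ratio p f c k < p.η₁ →
    t.σ (k + 1) ∈ Set.Icc (p.γ₁ * t.σ k) (p.γ₂ * t.σ k)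

/-- The trace is an execution of the algorithm with stopping tolerances `sg`, `sc`, `sH`: the loop
goes on exactly as long as the current iterate is not an approximate second-order stationary point
for any multiplier. If it stops, `lam` at the last point is a multiplier that passes the test. -/
structure IsRun (t : Trace n m) (p : Params) (f : Vec n → ℝ) (c : Vec n → Vec m)
    (sg sc sH : ℝ) : Prop where
  sigma_init : t.σ 0 = p.sigma0
  continues : ∀ k : ℕ, (k : ℕ∞) < t.N → ¬ ∃ y : Vec m, IsSOSPWith f c sg sc sH (t.x k) y
  step : ∀ k : ℕ, (k : ℕ∞) < t.N → t.Step p f c k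
  stops : ∀ k : ℕ, (k : ℕ∞) = t.N → IsSOSPWith f c sg sc sH (t.x k) (t.lam k)

/-- The set contains all iterates and all trial points. -/
structure StaysIn (t : Trace n m) (p : Params) (f : Vec n → ℝ) (c : Vec n → Vec m)
    (X : Set (Vec n)) : Prop where
  iterate : ∀ k : ℕ, (k : ℕ∞) ≤ t.N → t.x k ∈ X
  trial : ∀ k : ℕ, (k : ℕ∞) < t.N → t.x k + t.d k ∈ X
  corrected : ∀ k : ℕ, (k : ℕ∞) < t.N → t.Corrects p f c k → t.x k + t.d k + t.w k ∈ X

/-- `flow` bounds the objective from below at the initial point and at the successful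
iterations. -/
structure BoundedBelow (t : Trace n m) (p : Params) (f : Vec n → ℝ) (c : Vec n → Vec m)
    (flow : ℝ) : Prop where
  initial : flow ≤ f (t.x 0)
  successful : ∀ k : ℕ, (k : ℕ∞) < t.N → t.Successful p f c k → flow ≤ f (t.x k)

end Trace

/-- The constants of the assumptions on a problem with `m` constraints: `κ` for bounds and `L` for
Lipschitz constants; the suffix `f`, `g`, `fh` means the objective, its gradient, its Hessian, and
`c`, `dc`, `ch` the same for each constraint. -/
structure Consts (m : ℕ) where
  κf : ℝ≥0
  κg : ℝ≥0
  κfh : ℝ≥0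
  Lf : ℝ≥0
  Lg : ℝ≥0
  Lfh : ℝ≥0
  κc : Fin m → ℝ≥0
  κdc : Fin m → ℝ≥0
  κch : Fin m → ℝ≥0
  Lc : Fin m → ℝ≥0
  Ldc : Fin m → ℝ≥0
  Lch : Fin m → ℝ≥0
  γA : ℝ
  γA_pos : 0 < γA

/-- `F` is bounded by `κ` and Lipschitz with constant `L` on `X`. -/
def BddLip {E F : Type*} [PseudoEMetricSpace E] [SeminormedAddCommGroup F]
    (κ L : ℝ≥0) (φ : E → F) (X : Set E) : Prop :=
  (∀ x ∈ X, ‖φ x‖ ≤ κ) ∧ LipschitzOnWith L φ X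

/-- The standing assumptions on the problem over `X`. -/
structure Assumptions {n m : ℕ} (K : Consts m) (f : Vec n → ℝ) (c : Vec n → Vec m)
    (X : Set (Vec n)) : Prop where
  isOpen : IsOpen X
  convex : Convex ℝ X
  f_contDiff : ContDiffOn ℝ 2 f X
  c_contDiff : ContDiffOn ℝ 2 c X
  f_bdd : BddLip K.κf K.Lf f X
  g_bdd : BddLip K.κg K.Lg (gradient f) X
  c_bdd : ∀ i, BddLip (K.κc i) (K.Lc i) (fun x => c x i) X
  dc_bdd : ∀ i, BddLip (K.κdc i) (K.Ldc i) (gradient fun x => c x i) X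
  /-- the smallest singular value of the `m × n` matrix `A(x)` (the square root of the smallest
  eigenvalue of `A(x) A(x)ᵀ`) is at least `γA` -/
  licq : ∀ x ∈ X, ∀ y : Vec m, K.γA * ‖y‖ ≤ ‖jacT c x y‖
  fh_bdd : BddLip K.κfh K.Lfh (hess f) X
  ch_bdd : ∀ i, BddLip (K.κch i) (K.Lch i) (hess fun x => c x i) X

/-- The constant `κ_t` of the bound on successful iterations; `f0` is the initial objective
value. -/
def kappaT {m : ℕ} (K : Consts m) (p : Params) (f0 flow muMax α₁ α₂ α₃ : ℝ) : ℝ :=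
  (f0 - flow + 2 * (∑ i, (K.κc i : ℝ)) * muMax) / (p.η₁ * min α₁ (min α₂ α₃))

/-- The constant of the bound on all iterations. -/
def kappaTTilde (p : Params) (kT sigmaMax : ℝ) : ℝ :=
  (Real.log p.γ₁ - Real.log p.γ₃) * kT + sigmaMax / p.sigma0

end SCP

end

/-!
The proof follows the scheme of cubic regularization. Write `v`, `u`, `d` for the normal,
tangential and trial steps of an iteration.

*Bounds on the steps.* Full rank of the Jacobian bounds `v` by the constraint violation and bounds
the multipliers, hence the Hessians of the Lagrangian; the cubic term of the tangential model gives
`‖u‖ = O(σ^(-1/2))`, and `‖v‖ ≤ σ^(-1/2)` by the choice of `β`. The numerator of the trial merit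
parameter is `O(‖v‖)` and its denominator is at least of the order of `‖v‖`, so the merit parameters
are bounded (`Iter.muC_le`). By `Iter.deltaQ_ge` the predicted reduction of the merit function is at
least of the order of `‖v‖ + σ ‖u‖³`; it vanishes only at points where the algorithm stops
(`Iter.isSOSPWith_of_d_eq_zero`).

*The regularization parameter is bounded.* If the normal step is long, the predicted reduction
dominates the model error `O(‖d‖²) = O(1/σ)`. If it is short, a correction step is available: it
reduces the constraint violation to third order, and it moves the objective by the curvature of the
constraints that the model contains through the Hessian of the Lagrangian. Hence the model error is
`O(‖d‖³)`, which the cubic term absorbs. In both cases iterations with a large `σ` succeed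
(`Iter.successful_of_sigma_ge`).

*Decrease.* Let iteration `k` be successful. If `x_k` violates the constraints by more than `εc`,
the predicted reduction is at least of the order of `εc`. The gradient of the Lagrangian at
`x_(k+1)` is `O(‖v‖ + ‖u‖²)` (`Iter.norm_gradLag_next_le`): its normal part is controlled by the
rule for the multiplier at `x_(k+1)`, and its part in the null space of the Jacobian does not
depend on the multiplier and may be compared with the gradient of the tangential model. So if this
gradient exceeds `εg`, the predicted reduction is at least of the order of `εg^(3/2)`. There
remains the case of an iteration that leads from a nearly feasible point to an infeasible one;
such an iteration is charged to the next successful one, which starts at an infeasible point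
(`Run.account_step`). If there is no further one, the infeasibility of the last point is covered
by the slack in the term `2 κ_c μ_max` (`Run.account_total`).

*Counting.* Since the merit parameters increase, the merit decreases telescope up to the term with
`μ_max`, which bounds the number of successful iterations. An unsuccessful iteration multiplies `σ`
by at least `γ₁` and a successful one by at least `γ₃`, so the bound for `σ` controls the number of
all iterations (`Run.index_le`).
-/

namespace SCP

/-! ### The l1 norm -/

lemma l1_nonneg {m : ℕ} (y : Vec m) : 0 ≤ l1 y := Finset.sum_nonneg fun _ _ => abs_nonneg _

lemma l1_add_le {m : ℕ} (y z : Vec m) : l1 (y + z) ≤ l1 y + l1 z := by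
  unfold l1
  rw [← Finset.sum_add_distrib]
  exact Finset.sum_le_sum fun i _ => abs_add_le _ _

lemma l1_smul {m : ℕ} (a : ℝ) (y : Vec m) : l1 (a • y) = |a| * l1 y := by
  simp [l1, abs_mul, Finset.mul_sum]

lemma norm_le_l1 {m : ℕ} (y : Vec m) : ‖y‖ ≤ l1 y := by
  rw [EuclideanSpace.norm_eq]
  refine Real.sqrt_le_iff.mpr ⟨l1_nonneg y, ?_⟩
  exact Finset.sum_sq_le_sq_sum_of_nonneg fun i _ => norm_nonneg (y i)

lemma l1_eq_zero_iff {m : ℕ} {y : Vec m} : l1 y = 0 ↔ y = 0 := by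
  constructor
  · intro h
    exact norm_le_zero_iff.mp ((norm_le_l1 y).trans h.le)
  · rintro rfl
    simp [l1]

lemma abs_apply_le_norm {m : ℕ} (y : Vec m) (i : Fin m) : |y i| ≤ ‖y‖ :=
  PiLp.norm_apply_le y i

lemma l1_le_card_mul_norm {m : ℕ} (y : Vec m) : l1 y ≤ m * ‖y‖ := by
  refine (Finset.sum_le_sum fun i _ => abs_apply_le_norm y i).trans ?_
  simp

/-! ### Surjective operators, null-space projections and eigenvalues -/

section Operators

variable {E F : Type*} [NormedAddCommGroup E] [InnerProductSpace ℝ E] [FiniteDimensional ℝ E]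
  [NormedAddCommGroup F] [InnerProductSpace ℝ F]

lemma apply_starProjection_ker (A : E →L[ℝ] F) (z : E) :
    A ((LinearMap.ker A.toLinearMap).starProjection z) = 0 :=
  LinearMap.mem_ker.mp (Submodule.starProjection_apply_mem _ z)

variable [FiniteDimensional ℝ F]

open ContinuousLinearMap in
lemma mul_norm_le_norm_apply {A : E →L[ℝ] F} {γ : ℝ} (hγ : ∀ y, γ * ‖y‖ ≤ ‖adjoint A y‖)
    {w : E} (hw : w ∈ LinearMap.range (adjoint A).toLinearMap) : γ * ‖w‖ ≤ ‖A w‖ := by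
  obtain ⟨y, rfl⟩ := hw
  change γ * ‖adjoint A y‖ ≤ ‖A (adjoint A y)‖
  rcases (norm_nonneg (adjoint A y)).eq_or_lt' with h | h
  · rw [h, mul_zero]
    exact norm_nonneg _
  have h1 : ‖adjoint A y‖ ^ 2 ≤ ‖y‖ * ‖A (adjoint A y)‖ := by
    rw [← real_inner_self_eq_norm_sq, adjoint_inner_left]
    exact real_inner_le_norm _ _
  have h2 := hγ y
  rcases le_or_gt γ 0 with hneg | hpos
  · exact (mul_nonpos_of_nonpos_of_nonneg hneg h.le).trans (norm_nonneg _)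
  · refine le_of_mul_le_mul_left ?_ h
    calc ‖adjoint A y‖ * (γ * ‖adjoint A y‖) = γ * ‖adjoint A y‖ ^ 2 := by ring
      _ ≤ γ * (‖y‖ * ‖A (adjoint A y)‖) := by gcongr
      _ = (γ * ‖y‖) * ‖A (adjoint A y)‖ := by ring
      _ ≤ ‖adjoint A y‖ * ‖A (adjoint A y)‖ := by gcongr

lemma sub_starProjection_ker_mem_range (A : E →L[ℝ] F) (z : E) :
    z - (LinearMap.ker A.toLinearMap).starProjection z ∈
      LinearMap.range (ContinuousLinearMap.adjoint A).toLinearMap := by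
  have h := Submodule.sub_starProjection_mem_orthogonal (K := LinearMap.ker A.toLinearMap) z
  rw [LinearMap.orthogonal_ker] at h
  exact h

lemma starProjection_ker_adjoint (A : E →L[ℝ] F) (y : F) :
    (LinearMap.ker A.toLinearMap).starProjection (ContinuousLinearMap.adjoint A y) = 0 := by
  rw [Submodule.starProjection_apply_eq_zero_iff, LinearMap.orthogonal_ker]
  exact ⟨y, rfl⟩

lemma norm_sub_starProjection_ker_le {A : E →L[ℝ] F} {γ : ℝ} (hpos : 0 < γ)
    (hγ : ∀ y, γ * ‖y‖ ≤ ‖ContinuousLinearMap.adjoint A y‖) (z : E) :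
    ‖z - (LinearMap.ker A.toLinearMap).starProjection z‖ ≤ ‖A z‖ / γ := by
  rw [le_div_iff₀' hpos]
  refine (mul_norm_le_norm_apply hγ (sub_starProjection_ker_mem_range A z)).trans ?_
  rw [map_sub, apply_starProjection_ker, sub_zero]

/-- The null-space projection of a perturbed operator `B` is controlled by that of `A`: the part of
`z` in the range of the adjoint of `A` is almost in the range of the adjoint of `B`. -/
lemma norm_starProjection_ker_le {A B : E →L[ℝ] F} {γ ε : ℝ} (hpos : 0 < γ)
    (hγ : ∀ y, γ * ‖y‖ ≤ ‖ContinuousLinearMap.adjoint A y‖) (hε : ‖A - B‖ ≤ ε) (z : E) :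
    ‖(LinearMap.ker B.toLinearMap).starProjection z‖ ≤
      ‖(LinearMap.ker A.toLinearMap).starProjection z‖ +
        ε / γ * ‖z - (LinearMap.ker A.toLinearMap).starProjection z‖ := by
  obtain ⟨y, hy⟩ := sub_starProjection_ker_mem_range A z
  set P := (LinearMap.ker A.toLinearMap).starProjection
  set Q := (LinearMap.ker B.toLinearMap).starProjection with hQ
  have hQ1 : ∀ s, ‖Q s‖ ≤ ‖s‖ := fun s => by
    simpa using Q.le_of_opNorm_le (Submodule.starProjection_norm_le _) s
  have hy' : ContinuousLinearMap.adjoint A y = z - P z := hy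
  have h1 : Q (z - P z) = Q (ContinuousLinearMap.adjoint (A - B) y) := by
    rw [← hy', map_sub, sub_apply, map_sub, hQ, starProjection_ker_adjoint B y,
      sub_zero]
  have h2 : Q z = Q (P z) + Q (z - P z) := by rw [← map_add]; congr 1; abel
  have h3 : ‖ContinuousLinearMap.adjoint (A - B) y‖ ≤ ε * ‖y‖ := by
    refine ContinuousLinearMap.le_of_opNorm_le _ ?_ _
    rwa [LinearIsometryEquiv.norm_map]
  have hε0 : 0 ≤ ε := (norm_nonneg _).trans hε
  have h4 : ‖y‖ ≤ ‖z - P z‖ / γ := by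
    rw [le_div_iff₀' hpos, ← hy']
    exact hγ y
  calc ‖Q z‖ ≤ ‖Q (P z)‖ + ‖Q (z - P z)‖ := by rw [h2]; exact norm_add_le _ _
    _ ≤ ‖P z‖ + ε * ‖y‖ := by
      rw [h1]
      exact add_le_add (hQ1 _) ((hQ1 _).trans h3)
    _ ≤ ‖P z‖ + ε * (‖z - P z‖ / γ) := by gcongr
    _ = _ := by ring

/-- The Rayleigh quotient of a symmetric operator is bounded below by its eigenvalues. -/
lemma neg_mul_sq_le_inner_of_eigenvalue {T : E →L[ℝ] E} (hT : T.toLinearMap.IsSymmetric) {e : ℝ}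
    (he : ∀ a : ℝ, Module.End.HasEigenvalue T.toLinearMap a → -e ≤ a) (x : E) :
    -e * ‖x‖ ^ 2 ≤ inner ℝ x (T x) := by
  rcases eq_or_ne x 0 with rfl | hx
  · simp
  have : Nontrivial E := ⟨x, 0, hx⟩
  have h1 := he _ hT.hasEigenvalue_iInf_of_finiteDimensional
  have hb : BddBelow (Set.range fun y : {y : E // y ≠ 0} =>
      RCLike.re (inner ℝ (T.toLinearMap y) (y : E)) / ‖(y : E)‖ ^ 2) := by
    refine ⟨-‖T‖, ?_⟩
    rintro _ ⟨y, rfl⟩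
    exact neg_le_of_abs_le (T.rayleighQuotient_le_norm y)
  have h2 := ciInf_le hb ⟨x, hx⟩
  have hx2 : 0 < ‖x‖ ^ 2 := by positivity
  have h3 : -e ≤ inner ℝ x (T x) / ‖x‖ ^ 2 := by
    rw [real_inner_comm]
    exact h1.trans h2
  rwa [le_div_iff₀ hx2] at h3

end Operators

/-! ### Taylor estimates -/

section Taylor

variable {n : ℕ} {X : Set (Vec n)} {φ : Vec n → ℝ} {x s : Vec n} {L : ℝ≥0}

lemma hasGradientAt_of_contDiffOn (hX : IsOpen X) (hφ : ContDiffOn ℝ 2 φ X) (hx : x ∈ X) :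
    HasGradientAt φ (gradient φ x) x :=
  ((hφ.contDiffAt (hX.mem_nhds hx)).differentiableAt (by norm_num)).hasGradientAt

lemma hasFDerivAt_fderiv_of_contDiffOn (hX : IsOpen X) (hφ : ContDiffOn ℝ 2 φ X) (hx : x ∈ X) :
    HasFDerivAt (fderiv ℝ φ) (fderiv ℝ (fderiv ℝ φ) x) x :=
  (((hφ.contDiffAt (hX.mem_nhds hx)).fderiv_right (m := 1) (by norm_num)).differentiableAt
    (by norm_num)).hasFDerivAt

/-- The inverse of the Riesz isometry as a map linear over `ℝ`; Mathlib's version is semilinear. -/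
noncomputable def rieszInv (n : ℕ) : (Vec n →L[ℝ] ℝ) →L[ℝ] Vec n :=
  LinearMap.toContinuousLinearMap
    { toFun := (InnerProductSpace.toDual ℝ (Vec n)).symm
      map_add' := map_add _
      map_smul' := fun a y => by simp }

lemma hasFDerivAt_gradient_comp (hX : IsOpen X) (hφ : ContDiffOn ℝ 2 φ X) (hx : x ∈ X) :
    HasFDerivAt (gradient φ) (rieszInv n ∘L fderiv ℝ (fderiv ℝ φ) x) x :=
  (rieszInv n).hasFDerivAt.comp x (hasFDerivAt_fderiv_of_contDiffOn hX hφ hx)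

lemma hasFDerivAt_gradient (hX : IsOpen X) (hφ : ContDiffOn ℝ 2 φ X) (hx : x ∈ X) :
    HasFDerivAt (gradient φ) (hess φ x) x :=
  (hasFDerivAt_gradient_comp hX hφ hx).differentiableAt.hasFDerivAt

lemma hess_apply_inner (hX : IsOpen X) (hφ : ContDiffOn ℝ 2 φ X) (hx : x ∈ X) (v w : Vec n) :
    inner ℝ (hess φ x v) w = fderiv ℝ (fderiv ℝ φ) x v w := by
  have h : hess φ x = rieszInv n ∘L fderiv ℝ (fderiv ℝ φ) x :=
    (hasFDerivAt_gradient_comp hX hφ hx).fderiv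
  rw [h]
  exact InnerProductSpace.toDual_symm_apply

lemma hess_symm (hX : IsOpen X) (hφ : ContDiffOn ℝ 2 φ X) (hx : x ∈ X) (v w : Vec n) :
    inner ℝ (hess φ x v) w = inner ℝ v (hess φ x w) := by
  rw [real_inner_comm _ v, hess_apply_inner hX hφ hx, hess_apply_inner hX hφ hx]
  exact (hφ.contDiffAt (hX.mem_nhds hx)).isSymmSndFDerivAt (by simp) v w

lemma norm_sub_le_norm_of_mem_segment {y : Vec n} (hy : y ∈ segment ℝ x (x + s)) :
    ‖y - x‖ ≤ ‖s‖ := by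
  simpa using norm_sub_le_of_mem_segment hy

lemma abs_sub_gradient_le (hX : IsOpen X) (hc : Convex ℝ X) (hφ : ContDiffOn ℝ 2 φ X)
    (hL : LipschitzOnWith L (gradient φ) X) (hx : x ∈ X) (hxs : x + s ∈ X) :
    |φ (x + s) - φ x - inner ℝ (gradient φ x) s| ≤ L * ‖s‖ ^ 2 := by
  have hseg : segment ℝ x (x + s) ⊆ X := hc.segment_subset hx hxs
  have h := Convex.norm_image_sub_le_of_norm_hasFDerivWithin_le' (𝕜 := ℝ) (f := φ)
    (f' := fun y => InnerProductSpace.toDual ℝ (Vec n) (gradient φ y))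
    (φ := InnerProductSpace.toDual ℝ (Vec n) (gradient φ x)) (C := L * ‖s‖)
    (s := segment ℝ x (x + s)) (x := x) (y := x + s)
    (fun y hy => (hasGradientAt_of_contDiffOn hX hφ (hseg hy)).hasFDerivAt.hasFDerivWithinAt)
    (fun y hy => ?_) (convex_segment _ _) (left_mem_segment _ _ _) (right_mem_segment _ _ _)
  · simpa [pow_two, mul_assoc] using h
  · rw [← map_sub, LinearIsometryEquiv.norm_map]
    refine (hL.norm_sub_le (hseg hy) hx).trans ?_
    gcongr
    exact norm_sub_le_norm_of_mem_segment hy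

lemma norm_gradient_sub_hess_le (hX : IsOpen X) (hc : Convex ℝ X) (hφ : ContDiffOn ℝ 2 φ X)
    (hL : LipschitzOnWith L (hess φ) X) (hx : x ∈ X) (hxs : x + s ∈ X) :
    ‖gradient φ (x + s) - gradient φ x - hess φ x s‖ ≤ L * ‖s‖ ^ 2 := by
  have hseg : segment ℝ x (x + s) ⊆ X := hc.segment_subset hx hxs
  have h := Convex.norm_image_sub_le_of_norm_hasFDerivWithin_le' (𝕜 := ℝ) (f := gradient φ)
    (f' := hess φ) (φ := hess φ x) (C := L * ‖s‖)
    (s := segment ℝ x (x + s)) (x := x) (y := x + s)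
    (fun y hy => (hasFDerivAt_gradient hX hφ (hseg hy)).hasFDerivWithinAt)
    (fun y hy => ?_) (convex_segment _ _) (left_mem_segment _ _ _) (right_mem_segment _ _ _)
  · simpa [pow_two, mul_assoc] using h
  · refine (hL.norm_sub_le (hseg hy) hx).trans ?_
    gcongr
    exact norm_sub_le_norm_of_mem_segment hy

lemma abs_sub_quadratic_le (hX : IsOpen X) (hc : Convex ℝ X) (hφ : ContDiffOn ℝ 2 φ X)
    (hL : LipschitzOnWith L (hess φ) X) (hx : x ∈ X) (hxs : x + s ∈ X) :
    |φ (x + s) - φ x - inner ℝ (gradient φ x) s - 1 / 2 * inner ℝ s (hess φ x s)|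
      ≤ L * ‖s‖ ^ 3 := by
  have hseg : segment ℝ x (x + s) ⊆ X := hc.segment_subset hx hxs
  set D := InnerProductSpace.toDual ℝ (Vec n)
  have hq : ∀ y, HasFDerivAt (fun z => 1 / 2 * inner ℝ (z - x) (hess φ x (z - x)))
      (D (hess φ x (y - x))) y := fun y => by
    have h0 : HasFDerivAt (fun z : Vec n => z - x) (ContinuousLinearMap.id ℝ _) y :=
      (hasFDerivAt_id y).sub_const x
    have h1 := (h0.inner ℝ ((hess φ x).hasFDerivAt.comp y h0)).const_mul (1 / 2 : ℝ)
    refine h1.congr_fderiv ?_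
    ext v
    simp only [smul_apply, ContinuousLinearMap.comp_apply,
      ContinuousLinearMap.prod_apply, fderivInnerCLM_apply, ContinuousLinearMap.id_apply,
      smul_eq_mul, D, InnerProductSpace.toDual_apply_apply, Function.comp]
    rw [← hess_symm hX hφ hx (y - x) v, real_inner_comm v]
    ring
  have h := Convex.norm_image_sub_le_of_norm_hasFDerivWithin_le' (𝕜 := ℝ)
    (f := fun y => φ y - 1 / 2 * inner ℝ (y - x) (hess φ x (y - x)))
    (f' := fun y => D (gradient φ y) - D (hess φ x (y - x)))
    (φ := D (gradient φ x)) (C := L * ‖s‖ ^ 2)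
    (s := segment ℝ x (x + s)) (x := x) (y := x + s)
    (fun y hy => ((hasGradientAt_of_contDiffOn hX hφ (hseg hy)).hasFDerivAt.sub
      (hq y)).hasFDerivWithinAt)
    (fun y hy => ?_) (convex_segment _ _) (left_mem_segment _ _ _) (right_mem_segment _ _ _)
  · have e : φ (x + s) - φ x - inner ℝ (gradient φ x) s - 1 / 2 * inner ℝ s (hess φ x s) =
        φ (x + s) - 1 / 2 * inner ℝ (x + s - x) (hess φ x (x + s - x)) -
        (φ x - 1 / 2 * inner ℝ (x - x) (hess φ x (x - x))) - D (gradient φ x) (x + s - x) := by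
      simp [D]
      ring
    rw [e]
    refine h.trans_eq ?_
    simp
    ring
  · rw [← map_sub, ← map_sub, LinearIsometryEquiv.norm_map]
    have hxy : x + (y - x) = y := by abel
    have h2 := norm_gradient_sub_hess_le (s := y - x) hX hc hφ hL hx (by rw [hxy]; exact hseg hy)
    rw [hxy] at h2
    have e : gradient φ y - hess φ x (y - x) - gradient φ x =
      gradient φ y - gradient φ x - hess φ x (y - x) := by abel
    rw [e]
    refine h2.trans ?_
    gcongr
    exact norm_sub_le_norm_of_mem_segment hy

end Taylor

/-! ### Bounds on the problem functions -/

/-- A bound for the constraints in the l1 norm. -/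
noncomputable def Consts.conBound {m : ℕ} (K : Consts m) : ℝ := ∑ i, (K.κc i : ℝ)

/-- A bound for the Jacobian as an operator into the l1 norm. -/
noncomputable def Consts.jacBound {m : ℕ} (K : Consts m) : ℝ := ∑ i, (K.κdc i : ℝ)

/-- A Lipschitz constant of the Jacobian as an operator into the l1 norm. -/
noncomputable def Consts.jacLip {m : ℕ} (K : Consts m) : ℝ := ∑ i, (K.Ldc i : ℝ)

lemma Consts.conBound_nonneg {m : ℕ} (K : Consts m) : 0 ≤ K.conBound :=
  Finset.sum_nonneg fun _ _ => NNReal.coe_nonneg _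

lemma Consts.jacBound_nonneg {m : ℕ} (K : Consts m) : 0 ≤ K.jacBound :=
  Finset.sum_nonneg fun _ _ => NNReal.coe_nonneg _

lemma Consts.jacLip_nonneg {m : ℕ} (K : Consts m) : 0 ≤ K.jacLip :=
  Finset.sum_nonneg fun _ _ => NNReal.coe_nonneg _

/-- A bound for the Hessian of the Lagrangian when the multiplier has norm at most `b`. -/
noncomputable def Consts.hessBound {m : ℕ} (K : Consts m) (b : ℝ≥0) : ℝ≥0 :=
  K.κfh + ∑ i, b * K.κch i

/-- A Lipschitz constant of the Hessian of the Lagrangian when the multiplier has norm at most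
`b`. -/
noncomputable def Consts.hessLip {m : ℕ} (K : Consts m) (b : ℝ≥0) : ℝ≥0 :=
  K.Lfh + ∑ i, b * K.Lch i

namespace Assumptions

variable {n m : ℕ} {K : Consts m} {f : Vec n → ℝ} {c : Vec n → Vec m} {X : Set (Vec n)}
  {x s : Vec n}

lemma c_apply_contDiff (h : Assumptions K f c X) (i : Fin m) :
    ContDiffOn ℝ 2 (fun z => c z i) X :=
  contDiffOn_euclidean.mp h.c_contDiff i

lemma jac_apply (h : Assumptions K f c X) (hx : x ∈ X) (y : Vec n) (i : Fin m) :
    jac c x y i = inner ℝ (gradient (fun z => c z i) x) y := by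
  have h1 : HasFDerivAt c (jac c x) x :=
    ((h.c_contDiff.contDiffAt (h.isOpen.mem_nhds hx)).differentiableAt (by norm_num)).hasFDerivAt
  have h2 := (EuclideanSpace.proj (𝕜 := ℝ) i).hasFDerivAt.comp x h1
  have h3 := (hasGradientAt_of_contDiffOn h.isOpen (h.c_apply_contDiff i) hx).hasFDerivAt
  have h4 := congrArg (fun T : Vec n →L[ℝ] ℝ => T y) (h2.unique h3)
  simpa using h4

lemma l1_c_le (h : Assumptions K f c X) (hx : x ∈ X) : l1 (c x) ≤ K.conBound :=
  Finset.sum_le_sum fun i _ => (h.c_bdd i).1 x hx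

lemma l1_jac_le (h : Assumptions K f c X) (hx : x ∈ X) (y : Vec n) :
    l1 (jac c x y) ≤ K.jacBound * ‖y‖ := by
  rw [Consts.jacBound, Finset.sum_mul]
  refine Finset.sum_le_sum fun i _ => ?_
  rw [h.jac_apply hx]
  refine (abs_real_inner_le_norm _ _).trans ?_
  gcongr
  exact (h.dc_bdd i).1 x hx

lemma norm_jac_le (h : Assumptions K f c X) (hx : x ∈ X) (y : Vec n) :
    ‖jac c x y‖ ≤ K.jacBound * ‖y‖ := (norm_le_l1 _).trans (h.l1_jac_le hx y)

lemma l1_jac_sub_le (h : Assumptions K f c X) {x' : Vec n} (hx : x ∈ X) (hx' : x' ∈ X)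
    (y : Vec n) : l1 (jac c x y - jac c x' y) ≤ K.jacLip * ‖x - x'‖ * ‖y‖ := by
  rw [Consts.jacLip, Finset.sum_mul, Finset.sum_mul]
  refine Finset.sum_le_sum fun i _ => ?_
  rw [PiLp.sub_apply, h.jac_apply hx, h.jac_apply hx', ← inner_sub_left]
  refine (abs_real_inner_le_norm _ _).trans ?_
  gcongr
  exact (h.dc_bdd i).2.norm_sub_le hx hx'

lemma norm_jac_sub_le (h : Assumptions K f c X) {x' : Vec n} (hx : x ∈ X) (hx' : x' ∈ X) :
    ‖jac c x - jac c x'‖ ≤ K.jacLip * ‖x - x'‖ :=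
  ContinuousLinearMap.opNorm_le_bound _ (mul_nonneg K.jacLip_nonneg (norm_nonneg _))
    fun y => (norm_le_l1 _).trans (h.l1_jac_sub_le hx hx' y)

lemma l1_c_sub_jac_le (h : Assumptions K f c X) (hx : x ∈ X) (hxs : x + s ∈ X) :
    l1 (c (x + s) - c x - jac c x s) ≤ K.jacLip * ‖s‖ ^ 2 := by
  rw [Consts.jacLip, Finset.sum_mul]
  refine Finset.sum_le_sum fun i _ => ?_
  rw [PiLp.sub_apply, PiLp.sub_apply, h.jac_apply hx]
  exact abs_sub_gradient_le h.isOpen h.convex (h.c_apply_contDiff i) (h.dc_bdd i).2 hx hxs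

lemma jacT_eq_sum (h : Assumptions K f c X) (hx : x ∈ X) (y : Vec m) :
    jacT c x y = ∑ i, y i • gradient (fun z => c z i) x := by
  refine ext_inner_right ℝ fun v => ?_
  rw [jacT, ContinuousLinearMap.adjoint_inner_left, sum_inner, PiLp.inner_apply]
  refine Finset.sum_congr rfl fun i _ => ?_
  rw [h.jac_apply hx, real_inner_smul_left]
  simp [mul_comm]

lemma lagrangian_eq (f : Vec n → ℝ) (c : Vec n → Vec m) (y : Vec m) :
    (fun z => lagrangian f c z y) = fun z => f z + ∑ i, y i * c z i := by
  funext z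
  simp [lagrangian, PiLp.inner_apply, mul_comm]

lemma lagrangian_contDiff (h : Assumptions K f c X) (y : Vec m) :
    ContDiffOn ℝ 2 (fun z => lagrangian f c z y) X := by
  rw [lagrangian_eq]
  exact h.f_contDiff.add (ContDiffOn.sum fun i _ => contDiffOn_const.mul (h.c_apply_contDiff i))

lemma gradLag_eq_sum (h : Assumptions K f c X) (hx : x ∈ X) (y : Vec m) :
    gradient (fun z => lagrangian f c z y) x =
      gradient f x + ∑ i, y i • gradient (fun z => c z i) x := by
  refine HasGradientAt.gradient ?_
  rw [lagrangian_eq, hasGradientAt_iff_hasFDerivAt, map_add, map_sum]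
  refine (hasGradientAt_of_contDiffOn h.isOpen h.f_contDiff hx).hasFDerivAt.add
    (HasFDerivAt.fun_sum fun i _ => ?_)
  have := (hasGradientAt_of_contDiffOn h.isOpen (h.c_apply_contDiff i) hx).hasFDerivAt.const_mul
    (y i)
  simpa using this

lemma gradLag_eq (h : Assumptions K f c X) (hx : x ∈ X) (y : Vec m) :
    gradient (fun z => lagrangian f c z y) x = gradient f x + jacT c x y := by
  rw [h.gradLag_eq_sum hx, h.jacT_eq_sum hx]

lemma hessLag_eq (h : Assumptions K f c X) (hx : x ∈ X) (y : Vec m) :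
    hess (fun z => lagrangian f c z y) x = hessLag f c x y := by
  have h1 : gradient (fun z => lagrangian f c z y) =ᶠ[nhds x]
      fun z => gradient f z + ∑ i, y i • gradient (fun z => c z i) z :=
    Filter.eventuallyEq_of_mem (h.isOpen.mem_nhds hx) fun z hz => h.gradLag_eq_sum hz y
  rw [hess, h1.fderiv_eq]
  refine HasFDerivAt.fderiv ?_
  exact (hasFDerivAt_gradient h.isOpen h.f_contDiff hx).add (HasFDerivAt.fun_sum fun i _ =>
    (hasFDerivAt_gradient h.isOpen (h.c_apply_contDiff i) hx).const_smul (y i))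

lemma hessLag_symm (h : Assumptions K f c X) (hx : x ∈ X) (y : Vec m) (v w : Vec n) :
    inner ℝ (hessLag f c x y v) w = inner ℝ v (hessLag f c x y w) := by
  rw [← h.hessLag_eq hx]
  exact hess_symm h.isOpen (h.lagrangian_contDiff y) hx v w

lemma norm_hessLag_le (h : Assumptions K f c X) (hx : x ∈ X) {y : Vec m} {b : ℝ≥0}
    (hy : ‖y‖ ≤ b) : ‖hessLag f c x y‖ ≤ K.hessBound b := by
  rw [hessLag, Consts.hessBound]
  push_cast
  refine (norm_add_le _ _).trans (add_le_add (h.fh_bdd.1 x hx) ((norm_sum_le _ _).trans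
    (Finset.sum_le_sum fun i _ => ?_)))
  rw [norm_smul]
  exact mul_le_mul ((abs_apply_le_norm y i).trans hy) ((h.ch_bdd i).1 x hx) (norm_nonneg _) b.2

lemma lipschitz_hessLag (h : Assumptions K f c X) {y : Vec m} {b : ℝ≥0} (hy : ‖y‖ ≤ b) :
    LipschitzOnWith (K.hessLip b) (hess fun z => lagrangian f c z y) X := by
  refine LipschitzOnWith.of_dist_le_mul fun z hz z' hz' => ?_
  rw [h.hessLag_eq hz, h.hessLag_eq hz', dist_eq_norm, dist_eq_norm, hessLag, hessLag,
    add_sub_add_comm, ← Finset.sum_sub_distrib, Consts.hessLip]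
  push_cast
  rw [add_mul, Finset.sum_mul]
  refine (norm_add_le _ _).trans (add_le_add (h.fh_bdd.2.norm_sub_le hz hz') ((norm_sum_le _ _).trans
    (Finset.sum_le_sum fun i _ => ?_)))
  have e : y i • hess (fun z => c z i) z - y i • hess (fun z => c z i) z' =
      y i • (hess (fun z => c z i) z - hess (fun z => c z i) z') := (smul_sub _ _ _).symm
  rw [e, norm_smul, mul_assoc]
  exact mul_le_mul ((abs_apply_le_norm y i).trans hy) ((h.ch_bdd i).2.norm_sub_le hz hz')
    (norm_nonneg _) b.2

/-- Second-order Taylor expansion of the Lagrangian, solved for the objective. -/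
lemma f_add_le (h : Assumptions K f c X) (hx : x ∈ X) (hxs : x + s ∈ X) {y : Vec m} {b : ℝ≥0}
    (hy : ‖y‖ ≤ b) :
    f (x + s) ≤ f x + inner ℝ (gradient f x) s + 1 / 2 * inner ℝ s (hessLag f c x y s)
      + inner ℝ y (c x + jac c x s) + b * l1 (c (x + s)) + K.hessLip b * ‖s‖ ^ 3 := by
  have h1 := abs_sub_quadratic_le h.isOpen h.convex (h.lagrangian_contDiff y)
    (h.lipschitz_hessLag hy) hx hxs
  rw [h.gradLag_eq hx, h.hessLag_eq hx, inner_add_left, jacT,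
    ContinuousLinearMap.adjoint_inner_left] at h1
  have h2 := le_of_abs_le h1
  simp only [lagrangian] at h2
  have h3 : -(inner ℝ y (c (x + s))) ≤ b * l1 (c (x + s)) :=
    (neg_le_abs _).trans ((abs_real_inner_le_norm _ _).trans
      (mul_le_mul hy (norm_le_l1 _) (norm_nonneg _) b.2))
  rw [inner_add_right]
  linarith

lemma norm_gradLag_sub_le (h : Assumptions K f c X) (hx : x ∈ X) (hxs : x + s ∈ X) {y : Vec m}
    {b : ℝ≥0} (hy : ‖y‖ ≤ b) :
    ‖gradient f (x + s) + jacT c (x + s) y - (gradient f x + jacT c x y) - hessLag f c x y s‖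
      ≤ K.hessLip b * ‖s‖ ^ 2 := by
  have h1 := norm_gradient_sub_hess_le h.isOpen h.convex (h.lagrangian_contDiff y)
    (h.lipschitz_hessLag hy) hx hxs
  rwa [h.gradLag_eq hx, h.gradLag_eq hxs, h.hessLag_eq hx] at h1

lemma f_add_le_linear (h : Assumptions K f c X) (hx : x ∈ X) (hxs : x + s ∈ X) :
    f (x + s) ≤ f x + inner ℝ (gradient f x) s + K.Lg * ‖s‖ ^ 2 := by
  have h1 := le_of_abs_le
    (abs_sub_gradient_le h.isOpen h.convex h.f_contDiff h.g_bdd.2 hx hxs)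
  linarith

end Assumptions

/-! ### Step bounds at a single iteration -/

/-- A bound for the unscaled normal step. -/
noncomputable def vBound {m : ℕ} (K : Consts m) : ℝ := 2 * K.conBound / K.γA

/-- A bound for the multipliers. -/
noncomputable def lamBound {m : ℕ} (p : Params) (K : Consts m) : ℝ≥0 :=
  ((p.rl * vBound K + K.jacBound * K.κg) / K.γA ^ 2).toNNReal

/-- A bound for the Hessians of the Lagrangian along a run. -/
noncomputable def hBound {m : ℕ} (p : Params) (K : Consts m) : ℝ := K.hessBound (lamBound p K)

/-- A bound for `√σ ‖u‖`. -/
noncomputable def uBound {m : ℕ} (p : Params) (K : Consts m) : ℝ :=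
  3 * (K.κg + hBound p K * vBound K) + 1 + 3 * hBound p K / (2 * √p.sigmaMin)

/-- A bound for `√σ ‖d‖`. -/
noncomputable def dBound {m : ℕ} (p : Params) (K : Consts m) : ℝ := 1 + uBound p K

/-- A bound for the numerator of the trial merit parameter, relative to `‖v‖`. -/
noncomputable def numBound {m : ℕ} (p : Params) (K : Consts m) : ℝ :=
  K.κg + hBound p K * vBound K + dBound p K ^ 2

/-- A bound for the merit parameters. -/
noncomputable def muBound {m : ℕ} (p : Params) (K : Consts m) : ℝ :=
  p.muInit + p.ν * (numBound p K * 2 / (K.γA * (1 - p.rv - p.τ)))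

/-- What is known about a single iteration of a run: the rules of the algorithm, together with the
invariants of the two parameters and the location of the points involved. -/
structure Iter {n m : ℕ} (t : Trace n m) (p : Params) (K : Consts m) (f : Vec n → ℝ)
    (c : Vec n → Vec m) (X : Set (Vec n)) (k : ℕ) : Prop where
  ass : Assumptions K f c X
  step : t.Step p f c k
  sigmaMin_le : p.sigmaMin ≤ t.σ k
  muInit_le : p.muInit ≤ t.prevMu p k
  x_mem : t.x k ∈ X
  trial_mem : t.x k + t.d k ∈ X
  corrected_mem : t.Corrects p f c k → t.x k + t.d k + t.w k ∈ X

section Nonneg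

variable {m : ℕ} (p : Params) (K : Consts m)

lemma vBound_nonneg : 0 ≤ vBound K :=
  div_nonneg (mul_nonneg zero_le_two K.conBound_nonneg) K.γA_pos.le

lemma hBound_nonneg : 0 ≤ hBound p K := NNReal.coe_nonneg _

lemma uBound_nonneg : 0 ≤ uBound p K := by
  have := vBound_nonneg K
  have := hBound_nonneg p K
  unfold uBound
  positivity

lemma one_le_dBound : 1 ≤ dBound p K := by
  have := uBound_nonneg p K
  unfold dBound
  linarith

lemma numBound_nonneg : 0 ≤ numBound p K := by
  have := vBound_nonneg K
  have := hBound_nonneg p K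
  unfold numBound
  positivity

lemma one_sub_rv_sub_tau_pos : 0 < 1 - p.rv - p.τ := by linarith [p.rv_lt]

lemma muBound_pos : 0 < muBound p K := by
  have h1 := numBound_nonneg p K
  have h2 := one_sub_rv_sub_tau_pos p
  have h3 := K.γA_pos
  have h4 := p.muInit_pos
  have h5 := p.ν_gt
  unfold muBound
  have : 0 < p.ν := by linarith
  positivity

lemma muInit_le_muBound : p.muInit ≤ muBound p K := by
  have h1 := numBound_nonneg p K
  have h2 := one_sub_rv_sub_tau_pos p
  have h3 := K.γA_pos
  have h5 : 0 < p.ν := by linarith [p.ν_gt]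
  unfold muBound
  have : 0 ≤ p.ν * (numBound p K * 2 / (K.γA * (1 - p.rv - p.τ))) := by positivity
  linarith

end Nonneg

lemma Trace.norm_d_le {n m : ℕ} (t : Trace n m) (k : ℕ) : ‖t.d k‖ ≤ ‖t.v k‖ + ‖t.u k‖ := norm_add_le _ _

lemma inner_nullProj {n m : ℕ} (c : Vec n → Vec m) (x y z : Vec n) :
    inner ℝ (nullProj c x y) z = inner ℝ y (nullProj c x z) :=
  Submodule.inner_starProjection_left_eq_right _ _ _

lemma norm_nullProj_le {n m : ℕ} (c : Vec n → Vec m) (x y : Vec n) : ‖nullProj c x y‖ ≤ ‖y‖ := by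
  simpa using (nullProj c x).le_of_opNorm_le (Submodule.starProjection_norm_le _) y

namespace Iter

variable {n m : ℕ} {t : Trace n m} {p : Params} {K : Consts m} {f : Vec n → ℝ}
  {c : Vec n → Vec m} {X : Set (Vec n)} {k : ℕ}

lemma sigma_pos (h : Iter t p K f c X k) : 0 < t.σ k := p.sigmaMin_pos.trans_le h.sigmaMin_le

lemma sqrt_sigma_pos (h : Iter t p K f c X k) : 0 < √(t.σ k) := Real.sqrt_pos.mpr h.sigma_pos

lemma norm_jac_ge (h : Iter t p K f c X k) {w : Vec n}
    (hw : w ∈ LinearMap.range (jacT c (t.x k)).toLinearMap) :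
    K.γA * ‖w‖ ≤ ‖jac c (t.x k) w‖ :=
  mul_norm_le_norm_apply (h.ass.licq _ h.x_mem) hw

lemma norm_vc_le (h : Iter t p K f c X k) : K.γA * ‖t.vc k‖ ≤ 2 * l1 (c (t.x k)) := by
  refine (h.norm_jac_ge h.step.normal.mem_range).trans ((norm_le_l1 _).trans ?_)
  have h1 : jac c (t.x k) (t.vc k) =
      (jac c (t.x k) (t.vc k) + c (t.x k)) + (-1 : ℝ) • c (t.x k) := by simp
  have h2 := l1_add_le (jac c (t.x k) (t.vc k) + c (t.x k)) ((-1 : ℝ) • c (t.x k))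
  rw [← h1, l1_smul] at h2
  have h3 := h.step.normal.residual
  have h4 : p.rv * min (l1 (c (t.x k))) (‖t.vc k‖ ^ 3) ≤ 1 * l1 (c (t.x k)) := by
    have := l1_nonneg (c (t.x k))
    gcongr
    · linarith [p.rv_lt, p.τ_pos]
    · exact min_le_left _ _
  norm_num at h2
  linarith

lemma norm_vc_le_vBound (h : Iter t p K f c X k) : ‖t.vc k‖ ≤ vBound K := by
  rw [vBound, le_div_iff₀' K.γA_pos]
  exact h.norm_vc_le.trans (by linarith [h.ass.l1_c_le h.x_mem])

lemma l1_le_norm_vc (h : Iter t p K f c X k) :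
    (1 - p.rv) * l1 (c (t.x k)) ≤ K.jacBound * ‖t.vc k‖ := by
  have h1 : c (t.x k) =
      (jac c (t.x k) (t.vc k) + c (t.x k)) + (-1 : ℝ) • jac c (t.x k) (t.vc k) := by simp
  have h2 := l1_add_le (jac c (t.x k) (t.vc k) + c (t.x k)) ((-1 : ℝ) • jac c (t.x k) (t.vc k))
  rw [← h1, l1_smul] at h2
  have h3 := h.step.normal.residual
  have h4 : p.rv * min (l1 (c (t.x k))) (‖t.vc k‖ ^ 3) ≤ p.rv * l1 (c (t.x k)) :=
    mul_le_mul_of_nonneg_left (min_le_left _ _) p.rv_nonneg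
  have h5 := h.ass.l1_jac_le h.x_mem (t.vc k)
  norm_num at h2
  linarith

lemma vc_ne_zero (h : Iter t p K f c X k) (hc : c (t.x k) ≠ 0) : t.vc k ≠ 0 := by
  intro h0
  have h1 := h.l1_le_norm_vc
  have h2 : 0 < l1 (c (t.x k)) := (l1_nonneg _).lt_of_ne' (mt l1_eq_zero_iff.mp hc)
  rw [h0, norm_zero, mul_zero] at h1
  have h3 : 0 < 1 - p.rv := by linarith [p.rv_lt, p.τ_pos]
  have := mul_pos h3 h2
  linarith

lemma beta_pos (h : Iter t p K f c X k) : 0 < t.β k := by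
  by_cases hc : c (t.x k) = 0
  · rw [(h.step.normal.feasible hc).2]
    exact one_pos
  · refine lt_of_lt_of_le ?_ (h.step.normal.beta_mem hc).1
    have := norm_pos_iff.mpr (h.vc_ne_zero hc)
    have := h.sqrt_sigma_pos
    have := p.θ_pos
    exact lt_min one_pos (by positivity)

lemma beta_le_one (h : Iter t p K f c X k) : t.β k ≤ 1 := by
  by_cases hc : c (t.x k) = 0
  · rw [(h.step.normal.feasible hc).2]
  · exact (h.step.normal.beta_mem hc).2.trans (min_le_left _ _)

lemma norm_v_eq (h : Iter t p K f c X k) : ‖t.v k‖ = t.β k * ‖t.vc k‖ := by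
  rw [Trace.v, norm_smul, Real.norm_of_nonneg h.beta_pos.le]

lemma norm_v_le_norm_vc (h : Iter t p K f c X k) : ‖t.v k‖ ≤ ‖t.vc k‖ := by
  rw [h.norm_v_eq]
  exact mul_le_of_le_one_left (norm_nonneg _) h.beta_le_one

lemma norm_v_le_vBound (h : Iter t p K f c X k) : ‖t.v k‖ ≤ vBound K :=
  h.norm_v_le_norm_vc.trans h.norm_vc_le_vBound

lemma sqrt_mul_norm_v_le (h : Iter t p K f c X k) : √(t.σ k) * ‖t.v k‖ ≤ 1 := by
  rw [h.norm_v_eq]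
  by_cases hc : c (t.x k) = 0
  · rw [(h.step.normal.feasible hc).1]
    simp
  · have h1 := (h.step.normal.beta_mem hc).2.trans (min_le_right _ _)
    have h2 := norm_pos_iff.mpr (h.vc_ne_zero hc)
    have h3 := h.sqrt_sigma_pos
    rw [le_div_iff₀ (by positivity)] at h1
    linarith

lemma beta_mul_l1_ge (h : Iter t p K f c X k) :
    K.γA / 2 * ‖t.v k‖ ≤ t.β k * l1 (c (t.x k)) := by
  have h1 := mul_le_mul_of_nonneg_left h.norm_vc_le h.beta_pos.le
  rw [h.norm_v_eq]
  linarith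

lemma v_mem_range (h : Iter t p K f c X k) :
    t.v k ∈ LinearMap.range (jacT c (t.x k)).toLinearMap :=
  Submodule.smul_mem _ _ h.step.normal.mem_range

lemma nullProj_u (h : Iter t p K f c X k) : nullProj c (t.x k) (t.u k) = t.u k := by
  obtain ⟨y, hy⟩ := h.step.tangential.mem_range
  have hy' : nullProj c (t.x k) y = t.u k := hy
  rw [nullProj, Submodule.starProjection_eq_self_iff, ← hy']
  exact Submodule.starProjection_apply_mem _ _

lemma jac_u (h : Iter t p K f c X k) : jac c (t.x k) (t.u k) = 0 := by
  rw [← h.nullProj_u]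
  exact apply_starProjection_ker _ _

lemma inner_u_of_mem_range (h : Iter t p K f c X k) {w : Vec n}
    (hw : w ∈ LinearMap.range (jacT c (t.x k)).toLinearMap) : inner ℝ w (t.u k) = 0 := by
  obtain ⟨y, rfl⟩ := hw
  change inner ℝ (jacT c (t.x k) y) (t.u k) = 0
  rw [jacT, ContinuousLinearMap.adjoint_inner_left, h.jac_u, inner_zero_right]

lemma jac_d (h : Iter t p K f c X k) :
    jac c (t.x k) (t.d k) = t.β k • jac c (t.x k) (t.vc k) := by
  rw [Trace.d, map_add, h.jac_u, add_zero, Trace.v, map_smul]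

lemma norm_d_sq (h : Iter t p K f c X k) : ‖t.d k‖ ^ 2 = ‖t.v k‖ ^ 2 + ‖t.u k‖ ^ 2 := by
  rw [Trace.d, norm_add_sq_real, h.inner_u_of_mem_range h.v_mem_range]
  ring

lemma norm_v_le_norm_d (h : Iter t p K f c X k) : ‖t.v k‖ ≤ ‖t.d k‖ := by
  have := h.norm_d_sq
  exact (pow_le_pow_iff_left₀ (norm_nonneg _) (norm_nonneg _) two_ne_zero).mp
    (by nlinarith [sq_nonneg ‖t.u k‖])

lemma norm_u_le_norm_d (h : Iter t p K f c X k) : ‖t.u k‖ ≤ ‖t.d k‖ := by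
  have := h.norm_d_sq
  exact (pow_le_pow_iff_left₀ (norm_nonneg _) (norm_nonneg _) two_ne_zero).mp
    (by nlinarith [sq_nonneg ‖t.v k‖])

lemma norm_lam_le (h : Iter t p K f c X k) : ‖t.lam k‖ ≤ lamBound p K := by
  refine le_trans ?_ (Real.le_coe_toNNReal _)
  have hγ := K.γA_pos
  rw [le_div_iff₀' (by positivity)]
  have h1 : K.γA ^ 2 * ‖t.lam k‖ ≤ ‖jac c (t.x k) (jacT c (t.x k) (t.lam k))‖ := by
    refine le_trans ?_ (h.norm_jac_ge ⟨t.lam k, rfl⟩)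
    have := mul_le_mul_of_nonneg_left (h.ass.licq _ h.x_mem (t.lam k)) hγ.le
    linarith
  have h2 : jac c (t.x k) (jacT c (t.x k) (t.lam k)) =
      jac c (t.x k) (gradient f (t.x k) + jacT c (t.x k) (t.lam k)) -
        jac c (t.x k) (gradient f (t.x k)) := by
    rw [map_add]
    abel
  rw [h2] at h1
  have h3 := h.step.dual
  have h4 : ‖jac c (t.x k) (gradient f (t.x k))‖ ≤ K.jacBound * K.κg :=
    (h.ass.norm_jac_le h.x_mem _).trans
      (mul_le_mul_of_nonneg_left (h.ass.g_bdd.1 _ h.x_mem) K.jacBound_nonneg)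
  have h5 : p.rl * ‖t.v k‖ ≤ p.rl * vBound K :=
    mul_le_mul_of_nonneg_left h.norm_v_le_vBound p.rl_nonneg
  have h6 := norm_sub_le (jac c (t.x k) (gradient f (t.x k) + jacT c (t.x k) (t.lam k)))
    (jac c (t.x k) (gradient f (t.x k)))
  linarith

lemma norm_H_apply_le (h : Iter t p K f c X k) (y : Vec n) :
    ‖t.H f c k y‖ ≤ hBound p K * ‖y‖ :=
  (t.H f c k).le_of_opNorm_le (h.ass.norm_hessLag_le h.x_mem h.norm_lam_le) y

lemma abs_inner_H_le (h : Iter t p K f c X k) (y z : Vec n) :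
    |inner ℝ y (t.H f c k z)| ≤ hBound p K * ‖y‖ * ‖z‖ := by
  refine (abs_real_inner_le_norm _ _).trans ?_
  calc ‖y‖ * ‖t.H f c k z‖ ≤ ‖y‖ * (hBound p K * ‖z‖) := by gcongr; exact h.norm_H_apply_le z
    _ = _ := by ring

lemma H_symm (h : Iter t p K f c X k) (y z : Vec n) :
    inner ℝ (t.H f c k y) z = inner ℝ y (t.H f c k z) :=
  h.ass.hessLag_symm h.x_mem _ _ _

lemma HTilde_symm (h : Iter t p K f c X k) (y z : Vec n) :
    inner ℝ (t.HTilde f c k y) z = inner ℝ y (t.HTilde f c k z) := by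
  simp only [Trace.HTilde, ContinuousLinearMap.comp_apply]
  rw [inner_nullProj, h.H_symm, ← inner_nullProj]

/-! ### The reduced cubic model -/

lemma hasGradientAt_mU (h : Iter t p K f c X k) :
    HasGradientAt (t.mU f c k)
      (t.gTilde f c k + t.HTilde f c k (t.u k) + (t.σ k * ‖t.u k‖) • t.u k) (t.u k) := by
  rw [hasGradientAt_iff_hasFDerivAt]
  have h0 : HasFDerivAt (fun y : Vec n => y) (ContinuousLinearMap.id ℝ _) (t.u k) :=
    hasFDerivAt_id _
  have h1 := (hasFDerivAt_const (t.gTilde f c k) (t.u k)).inner ℝ h0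
  have h2 := (h0.inner ℝ ((t.HTilde f c k).hasFDerivAt.comp (t.u k) h0)).const_mul (1 / 2 : ℝ)
  have h3 := ((hasFDerivAt_norm_rpow (nullProj c (t.x k) (t.u k))
    (show (1 : ℝ) < 3 by norm_num)).comp (t.u k)
      (nullProj c (t.x k)).hasFDerivAt).const_mul (t.σ k / 3)
  have h4 := ((h1.const_add (f (t.x k))).add h2).add h3
  refine (h4.congr_of_eventuallyEq (Filter.Eventually.of_forall fun y => ?_)).congr_fderiv ?_
  · simp [Trace.mU]
  · ext z
    have e1 : inner ℝ (t.u k) (nullProj c (t.x k) z) = inner ℝ (t.u k) z := by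
      rw [← inner_nullProj, h.nullProj_u]
    have e2 : inner ℝ (t.u k) (t.HTilde f c k z) = inner ℝ (t.HTilde f c k (t.u k)) z :=
      (h.HTilde_symm _ _).symm
    have e3 : inner ℝ z (t.HTilde f c k (t.u k)) = inner ℝ (t.HTilde f c k (t.u k)) z :=
      real_inner_comm _ _
    have e4 : (3 : ℝ) - 2 = 1 := by norm_num
    simp only [add_apply, smul_apply, ContinuousLinearMap.comp_apply,
      ContinuousLinearMap.prod_apply, fderivInnerCLM_apply, ContinuousLinearMap.id_apply,
      smul_eq_mul, InnerProductSpace.toDual_apply_apply, h.nullProj_u, innerSL_apply_apply, e1,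
      e2, e3, e4, Real.rpow_one, inner_add_left, real_inner_smul_left, zero_apply, inner_zero_left,
      Function.comp]
    ring

lemma gradient_mU (h : Iter t p K f c X k) :
    gradient (t.mU f c k) (t.u k) =
      t.gTilde f c k + t.HTilde f c k (t.u k) + (t.σ k * ‖t.u k‖) • t.u k :=
  h.hasGradientAt_mU.gradient

lemma HTilde_u (h : Iter t p K f c X k) :
    t.HTilde f c k (t.u k) = nullProj c (t.x k) (t.H f c k (t.u k)) := by
  simp only [Trace.HTilde, ContinuousLinearMap.comp_apply, h.nullProj_u]

/-- The projected gradient of the quadratic model is of second order in the tangential step. -/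
lemma norm_nullProj_model_gradient_le (h : Iter t p K f c X k) :
    ‖nullProj c (t.x k) (gradient f (t.x k) + t.H f c k (t.d k))‖ ≤ 2 * t.σ k * ‖t.u k‖ ^ 2 := by
  have h1 : nullProj c (t.x k) (gradient f (t.x k) + t.H f c k (t.d k)) =
      gradient (t.mU f c k) (t.u k) - (t.σ k * ‖t.u k‖) • t.u k := by
    rw [h.gradient_mU, h.HTilde_u, Trace.gTilde, ← map_add, Trace.d, map_add (t.H f c k)]
    rw [add_sub_cancel_right, add_assoc]
  rw [h1]
  refine (norm_sub_le _ _).trans ?_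
  have h2 := h.step.tangential.gradient_le
  have h3 : ‖(t.σ k * ‖t.u k‖) • t.u k‖ = t.σ k * ‖t.u k‖ ^ 2 := by
    have := h.sigma_pos
    rw [norm_smul, Real.norm_of_nonneg (by positivity)]
    ring
  have h4 : p.δ * t.σ k * ‖t.u k‖ ^ 2 ≤ 1 * t.σ k * ‖t.u k‖ ^ 2 := by
    have := h.sigma_pos
    gcongr
    linarith [p.δ_lt]
  linarith

lemma inner_gTilde_u (h : Iter t p K f c X k) :
    inner ℝ (t.gTilde f c k) (t.u k) =
      inner ℝ (gradient f (t.x k)) (t.u k) + inner ℝ (t.v k) (t.H f c k (t.u k)) := by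
  rw [Trace.gTilde, inner_nullProj, h.nullProj_u, inner_add_left, h.H_symm]

lemma inner_HTilde_u (h : Iter t p K f c X k) :
    inner ℝ (t.u k) (t.HTilde f c k (t.u k)) = inner ℝ (t.u k) (t.H f c k (t.u k)) := by
  rw [h.HTilde_u, ← inner_nullProj, h.nullProj_u]

lemma deltaMU_eq (h : Iter t p K f c X k) :
    t.deltaMU f c k (t.u k) = -inner ℝ (t.gTilde f c k) (t.u k)
      - 1 / 2 * inner ℝ (t.u k) (t.H f c k (t.u k)) - t.σ k / 3 * ‖t.u k‖ ^ 3 := by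
  simp only [Trace.deltaMU, Trace.mU, h.nullProj_u, h.inner_HTilde_u]
  simp
  ring

lemma deltaMU_nonneg (h : Iter t p K f c X k) : 0 ≤ t.deltaMU f c k (t.u k) := by
  obtain ⟨α, hα, hmin, hle⟩ := h.step.tangential.cauchy
  refine le_trans ?_ hle
  have h1 : t.mU f c k (-(α • t.gTilde f c k)) ≤ t.mU f c k (-((0 : ℝ) • t.gTilde f c k)) :=
    hmin (Set.mem_Ici.mpr le_rfl)
  rw [zero_smul, neg_zero] at h1
  rw [Trace.deltaMU]
  linarith

lemma neg_mul_sq_le_inner_HTilde (h : Iter t p K f c X k) (z : Vec n) :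
    -(t.σ k * ‖t.u k‖) * ‖z‖ ^ 2 ≤ inner ℝ z (t.HTilde f c k z) :=
  neg_mul_sq_le_inner_of_eigenvalue (fun y z => h.HTilde_symm y z) h.step.tangential.curvature z

/-- The second-order requirements on the tangential step force a cubic decrease of the model. -/
lemma deltaMU_ge (h : Iter t p K f c X k) :
    (1 / 6 - p.δ) * t.σ k * ‖t.u k‖ ^ 3 ≤ t.deltaMU f c k (t.u k) := by
  have h1 : inner ℝ (gradient (t.mU f c k) (t.u k)) (t.u k) ≤ p.δ * t.σ k * ‖t.u k‖ ^ 3 := by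
    refine (real_inner_le_norm _ _).trans ?_
    have := mul_le_mul_of_nonneg_right h.step.tangential.gradient_le (norm_nonneg (t.u k))
    linarith
  have h2 := h.neg_mul_sq_le_inner_HTilde (t.u k)
  rw [h.inner_HTilde_u] at h2
  rw [h.gradient_mU, inner_add_left, inner_add_left, real_inner_smul_left,
    real_inner_self_eq_norm_sq, h.HTilde_symm, h.inner_HTilde_u] at h1
  rw [h.deltaMU_eq]
  nlinarith

lemma norm_gTilde_le (h : Iter t p K f c X k) :
    ‖t.gTilde f c k‖ ≤ K.κg + hBound p K * vBound K := by
  refine (norm_nullProj_le _ _ _).trans ((norm_add_le _ _).trans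
    (add_le_add (h.ass.g_bdd.1 _ h.x_mem) ((h.norm_H_apply_le _).trans ?_)))
  exact mul_le_mul_of_nonneg_left h.norm_v_le_vBound (hBound_nonneg p K)

lemma sqrt_mul_norm_u_le (h : Iter t p K f c X k) : √(t.σ k) * ‖t.u k‖ ≤ uBound p K := by
  have h0 := h.deltaMU_nonneg
  rw [h.deltaMU_eq] at h0
  have h1 : -inner ℝ (t.gTilde f c k) (t.u k) ≤ (K.κg + hBound p K * vBound K) * ‖t.u k‖ :=
    (neg_le_abs _).trans ((abs_real_inner_le_norm _ _).trans
      (mul_le_mul_of_nonneg_right h.norm_gTilde_le (norm_nonneg _)))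
  have h2 : -inner ℝ (t.u k) (t.H f c k (t.u k)) ≤ hBound p K * ‖t.u k‖ * ‖t.u k‖ :=
    (neg_le_abs _).trans (h.abs_inner_H_le _ _)
  have hs := h.sqrt_sigma_pos
  have hss : √(t.σ k) ^ 2 = t.σ k := Real.sq_sqrt h.sigma_pos.le
  have hm : 0 < √p.sigmaMin := Real.sqrt_pos.mpr p.sigmaMin_pos
  have hms : √p.sigmaMin ≤ √(t.σ k) := Real.sqrt_le_sqrt h.sigmaMin_le
  have hH := hBound_nonneg p K
  have hV := vBound_nonneg K
  set a := K.κg + hBound p K * vBound K with ha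
  have ha0 : 0 ≤ a := by positivity
  set z := ‖t.u k‖
  have hz : 0 ≤ z := norm_nonneg _
  set r := √(t.σ k)
  by_contra! hlt
  rw [uBound, ← ha] at hlt
  have hzpos : 0 < z := by
    rcases hz.eq_or_lt' with h' | h'
    · rw [h', mul_zero] at hlt
      have : 0 ≤ 3 * hBound p K / (2 * √p.sigmaMin) := by positivity
      linarith
    · exact h'
  -- dividing the model decrease by `‖u‖` leaves a quadratic inequality for `√σ ‖u‖`
  have h3 : (r * z) ^ 2 ≤ 3 * a + 3 / 2 * hBound p K * z := by
    refine le_of_mul_le_mul_right ?_ hzpos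
    have : (r * z) ^ 2 * z = t.σ k * z ^ 3 := by rw [mul_pow, hss]; ring
    rw [this]
    linarith
  have h4 : 3 / 2 * hBound p K * z ≤ 3 * hBound p K / (2 * √p.sigmaMin) * (r * z) := by
    rw [div_mul_eq_mul_div (3 * hBound p K), le_div_iff₀ (by positivity)]
    have := mul_le_mul_of_nonneg_left hms (by positivity : 0 ≤ 3 * hBound p K * z)
    linarith
  set b := 3 * hBound p K / (2 * √p.sigmaMin)
  have hb : 0 ≤ b := by positivity
  nlinarith

lemma sqrt_mul_norm_d_le (h : Iter t p K f c X k) : √(t.σ k) * ‖t.d k‖ ≤ dBound p K := by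
  have h1 := mul_le_mul_of_nonneg_left (t.norm_d_le k) h.sqrt_sigma_pos.le
  have h2 := h.sqrt_mul_norm_u_le
  have h3 := h.sqrt_mul_norm_v_le
  rw [dBound]
  linarith

lemma sigma_mul_norm_d_sq_le (h : Iter t p K f c X k) :
    t.σ k * ‖t.d k‖ ^ 2 ≤ dBound p K ^ 2 := by
  have h1 := pow_le_pow_left₀ (by positivity) h.sqrt_mul_norm_d_le 2
  rwa [mul_pow, Real.sq_sqrt h.sigma_pos.le] at h1

lemma norm_d_le_div (h : Iter t p K f c X k) : ‖t.d k‖ ≤ dBound p K / √p.sigmaMin := by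
  rw [le_div_iff₀' (Real.sqrt_pos.mpr p.sigmaMin_pos)]
  refine le_trans ?_ h.sqrt_mul_norm_d_le
  gcongr
  exact h.sigmaMin_le

/-! ### The merit parameter and the predicted reduction -/

/-- The model increase that the normal step may cause; it is the numerator of the trial merit
parameter. -/
lemma normal_increase_le (h : Iter t p K f c X k) :
    inner ℝ (gradient f (t.x k)) (t.v k) + 1 / 2 * inner ℝ (t.v k) (t.H f c k (t.v k))
      + t.σ k / 3 * (‖t.d k‖ ^ 3 - ‖t.u k‖ ^ 3) ≤ numBound p K * ‖t.v k‖ := by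
  have h1 : inner ℝ (gradient f (t.x k)) (t.v k) ≤ K.κg * ‖t.v k‖ :=
    (real_inner_le_norm _ _).trans
      (mul_le_mul_of_nonneg_right (h.ass.g_bdd.1 _ h.x_mem) (norm_nonneg _))
  have hH := hBound_nonneg p K
  have h2 : inner ℝ (t.v k) (t.H f c k (t.v k)) ≤ hBound p K * vBound K * ‖t.v k‖ := by
    refine (le_of_abs_le (h.abs_inner_H_le _ _)).trans ?_
    gcongr
    exact h.norm_v_le_vBound
  have h2' : 0 ≤ hBound p K * vBound K * ‖t.v k‖ := by
    have := vBound_nonneg K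
    positivity
  have h3 : ‖t.d k‖ ^ 3 - ‖t.u k‖ ^ 3 ≤ ‖t.v k‖ * (3 * ‖t.d k‖ ^ 2) := by
    have e : ‖t.d k‖ ^ 3 - ‖t.u k‖ ^ 3 =
        (‖t.d k‖ - ‖t.u k‖) * (‖t.d k‖ ^ 2 + ‖t.d k‖ * ‖t.u k‖ + ‖t.u k‖ ^ 2) := by ring
    rw [e]
    have hu := h.norm_u_le_norm_d
    have hd := t.norm_d_le k
    have h0 := norm_nonneg (t.u k)
    have h00 := norm_nonneg (t.d k)
    apply mul_le_mul
    · linarith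
    · nlinarith
    · positivity
    · positivity
  have h4 : t.σ k / 3 * (‖t.d k‖ ^ 3 - ‖t.u k‖ ^ 3) ≤ dBound p K ^ 2 * ‖t.v k‖ := by
    have hs := h.sigma_pos
    calc t.σ k / 3 * (‖t.d k‖ ^ 3 - ‖t.u k‖ ^ 3)
        ≤ t.σ k / 3 * (‖t.v k‖ * (3 * ‖t.d k‖ ^ 2)) := by gcongr
      _ = (t.σ k * ‖t.d k‖ ^ 2) * ‖t.v k‖ := by ring
      _ ≤ _ := by gcongr; exact h.sigma_mul_norm_d_sq_le
  rw [numBound]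
  linarith

lemma muC_le (h : Iter t p K f c X k) :
    t.muC p f c k ≤ numBound p K * 2 / (K.γA * (1 - p.rv - p.τ)) := by
  have h1 := one_sub_rv_sub_tau_pos p
  have h2 := numBound_nonneg p K
  have h3 := K.γA_pos
  rw [Trace.muC]
  split_ifs with hc
  · positivity
  · have h4 : 0 < l1 (c (t.x k)) := (l1_nonneg _).lt_of_ne' hc
    have h5 := h.beta_pos
    rw [div_le_div_iff₀ (by positivity) (by positivity)]
    have h6 := h.normal_increase_le
    have h7 := h.beta_mul_l1_ge
    calc _ ≤ numBound p K * ‖t.v k‖ * (K.γA * (1 - p.rv - p.τ)) := by gcongr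
      _ = numBound p K * 2 * (1 - p.rv - p.τ) * (K.γA / 2 * ‖t.v k‖) := by ring
      _ ≤ numBound p K * 2 * (1 - p.rv - p.τ) * (t.β k * l1 (c (t.x k))) := by gcongr
      _ = _ := by ring

lemma prevMu_le_mu (h : Iter t p K f c X k) : t.prevMu p k ≤ t.μ k := by
  rw [h.step.mu_update]
  split_ifs with hlt
  · have := h.muInit_le
    have := p.muInit_pos
    nlinarith [p.ν_gt]
  · exact le_rfl

lemma muC_le_mu (h : Iter t p K f c X k) : t.muC p f c k ≤ t.μ k := by
  rw [h.step.mu_update]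
  split_ifs with hlt
  · have := h.muInit_le
    have := p.muInit_pos
    nlinarith [p.ν_gt]
  · exact not_lt.mp hlt

lemma muInit_le_mu (h : Iter t p K f c X k) : p.muInit ≤ t.μ k := h.muInit_le.trans h.prevMu_le_mu

lemma mu_pos (h : Iter t p K f c X k) : 0 < t.μ k := p.muInit_pos.trans_le h.muInit_le_mu

lemma mu_le_muBound (h : Iter t p K f c X k) (hp : t.prevMu p k ≤ muBound p K) :
    t.μ k ≤ muBound p K := by
  rw [h.step.mu_update]
  split_ifs with hlt
  · have h1 := mul_le_mul_of_nonneg_left h.muC_le (zero_le_one.trans p.ν_gt.le)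
    rw [muBound]
    linarith [p.muInit_pos]
  · exact hp

lemma l1_c_add_jac_d_le (h : Iter t p K f c X k) :
    l1 (c (t.x k) + jac c (t.x k) (t.d k)) ≤
      (1 - t.β k * (1 - p.rv)) * l1 (c (t.x k)) := by
  have e : c (t.x k) + jac c (t.x k) (t.d k) = (1 - t.β k) • c (t.x k) +
      t.β k • (jac c (t.x k) (t.vc k) + c (t.x k)) := by
    rw [h.jac_d]
    module
  have h1 := h.beta_pos
  have h2 := h.beta_le_one
  rw [e]
  refine (l1_add_le _ _).trans ?_
  rw [l1_smul, l1_smul, abs_of_nonneg (by linarith : 0 ≤ 1 - t.β k), abs_of_pos h1]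
  have h3 := h.step.normal.residual
  have h4 : p.rv * min (l1 (c (t.x k))) (‖t.vc k‖ ^ 3) ≤ p.rv * l1 (c (t.x k)) :=
    mul_le_mul_of_nonneg_left (min_le_left _ _) p.rv_nonneg
  have h5 := mul_le_mul_of_nonneg_left (h3.trans h4) h1.le
  linarith

/-- The merit parameter is large enough for the predicted reduction to dominate a fraction of the
linearized constraint reduction as well as the reduction of the tangential model. -/
lemma deltaQ_ge (h : Iter t p K f c X k) :
    p.τ * t.μ k * (t.β k * l1 (c (t.x k))) + (1 / 6 - p.δ) * t.σ k * ‖t.u k‖ ^ 3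
      ≤ t.deltaQ f c k := by
  have h1 := h.deltaMU_ge
  rw [h.deltaMU_eq, h.inner_gTilde_u] at h1
  have h2 := mul_le_mul_of_nonneg_left h.l1_c_add_jac_d_le h.mu_pos.le
  have h3 : inner ℝ (gradient f (t.x k)) (t.v k) + 1 / 2 * inner ℝ (t.v k) (t.H f c k (t.v k))
      + t.σ k / 3 * (‖t.d k‖ ^ 3 - ‖t.u k‖ ^ 3) ≤
      t.μ k * ((1 - p.rv - p.τ) * (t.β k * l1 (c (t.x k)))) := by
    by_cases hc : l1 (c (t.x k)) = 0
    · have hv : ‖t.v k‖ = 0 := by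
        have := h.beta_mul_l1_ge
        rw [hc, mul_zero] at this
        have h0 := K.γA_pos
        exact le_antisymm (by nlinarith [norm_nonneg (t.v k)]) (norm_nonneg _)
      have := h.normal_increase_le
      rw [hv] at this
      rw [hc]
      linarith
    · have h4 := h.muC_le_mu
      have h5 : 0 < l1 (c (t.x k)) := (l1_nonneg _).lt_of_ne' hc
      have h6 := h.beta_pos
      have h7 := one_sub_rv_sub_tau_pos p
      rw [Trace.muC, if_neg hc, div_le_iff₀ (by positivity)] at h4
      linarith
  have e1 : inner ℝ (gradient f (t.x k)) (t.d k) =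
      inner ℝ (gradient f (t.x k)) (t.v k) + inner ℝ (gradient f (t.x k)) (t.u k) := by
    rw [Trace.d, inner_add_right]
  have e2 : inner ℝ (t.d k) (t.H f c k (t.d k)) = inner ℝ (t.v k) (t.H f c k (t.v k)) +
      2 * inner ℝ (t.v k) (t.H f c k (t.u k)) + inner ℝ (t.u k) (t.H f c k (t.u k)) := by
    rw [Trace.d, map_add, inner_add_right, inner_add_left, inner_add_left, ← h.H_symm (t.u k),
      real_inner_comm (t.v k) (t.H f c k (t.u k))]
    ring
  have e3 : t.q f c k 0 = f (t.x k) + t.μ k * l1 (c (t.x k)) := by simp [Trace.q]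
  rw [Trace.deltaQ, e3, Trace.q, e1, e2]
  linarith

end Iter

/-! ### Iterations with a large regularization parameter are successful -/

section Bounds

variable {m : ℕ} (p : Params) (K : Consts m)

/-- A bound for `‖d‖`. -/
noncomputable def stepBound : ℝ := dBound p K / √p.sigmaMin

/-- The rate at which the predicted reduction grows with the normal step. -/
noncomputable def normalRate : ℝ := p.τ * p.muInit * (K.γA / 2)

/-- A bound for a correction step, relative to `‖d‖²`. -/
noncomputable def corrBound : ℝ :=
  (p.rw * stepBound p K + (p.rv * stepBound p K + K.jacLip)) / K.γA

/-- A bound for a corrected trial step, relative to `‖d‖`. -/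
noncomputable def corrStepBound : ℝ := 1 + corrBound p K * stepBound p K

/-- A bound for the constraint violation after a correction, relative to `‖d‖³`. -/
noncomputable def corrConBound : ℝ :=
  K.jacLip * corrBound p K ^ 2 * stepBound p K + K.jacLip * corrBound p K + m * p.rw

/-- A bound for the error of the quadratic model of the objective at a corrected trial point,
relative to `‖d‖³`. -/
noncomputable def corrObjBound : ℝ :=
  hBound p K * corrBound p K + hBound p K * corrBound p K ^ 2 * stepBound p K
    + p.rl * corrBound p K / K.γA + lamBound p K * p.rv + lamBound p K * corrConBound p K
    + K.hessLip (lamBound p K) * corrStepBound p K ^ 3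

/-- A bound for the error of the model of the merit function at an uncorrected trial point,
relative to `‖d‖²`. -/
noncomputable def trialBound : ℝ := K.Lg + hBound p K / 2 + muBound p K * K.jacLip

/-- Iterations whose regularization parameter is at least this large are successful. -/
noncomputable def sigmaSuccess : ℝ :=
  3 * (corrObjBound p K + muBound p K * corrConBound p K) +
    (trialBound p K * dBound p K ^ 2 / ((1 - p.η₁) * normalRate p K * p.ζ)) ^ 2

lemma stepBound_pos : 0 < stepBound p K :=
  div_pos (zero_lt_one.trans_le (one_le_dBound p K)) (Real.sqrt_pos.mpr p.sigmaMin_pos)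

lemma normalRate_pos : 0 < normalRate p K := by
  have := p.τ_pos
  have := p.muInit_pos
  have := K.γA_pos
  unfold normalRate
  positivity

lemma corrBound_nonneg : 0 ≤ corrBound p K := by
  have := p.rw_nonneg
  have := p.rv_nonneg
  have := K.γA_pos
  have := K.jacLip_nonneg
  have := stepBound_pos p K
  unfold corrBound
  positivity

lemma corrStepBound_pos : 0 < corrStepBound p K := by
  have := corrBound_nonneg p K
  have := stepBound_pos p K
  unfold corrStepBound
  positivity

lemma corrConBound_nonneg : 0 ≤ corrConBound p K := by
  have := p.rw_nonneg
  have := K.jacLip_nonneg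
  have := stepBound_pos p K
  have := corrBound_nonneg p K
  unfold corrConBound
  positivity

lemma corrObjBound_nonneg : 0 ≤ corrObjBound p K := by
  have := p.rv_nonneg
  have := p.rl_nonneg
  have := K.γA_pos
  have := stepBound_pos p K
  have := corrBound_nonneg p K
  have := corrConBound_nonneg p K
  have := corrStepBound_pos p K
  have := hBound_nonneg p K
  unfold corrObjBound
  positivity

lemma trialBound_nonneg : 0 ≤ trialBound p K := by
  have := hBound_nonneg p K
  have := muBound_pos p K
  have := K.jacLip_nonneg
  unfold trialBound
  positivity

end Bounds

lemma merit_eq_q_zero {n m : ℕ} (t : Trace n m) (f : Vec n → ℝ) (c : Vec n → Vec m) (k : ℕ) :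
    merit f c (t.x k) (t.μ k) = t.q f c k 0 := by simp [merit, Trace.q]

namespace Iter

variable {n m : ℕ} {t : Trace n m} {p : Params} {K : Consts m} {f : Vec n → ℝ}
  {c : Vec n → Vec m} {X : Set (Vec n)} {k : ℕ}

lemma deltaQ_ge_normal (h : Iter t p K f c X k) :
    normalRate p K * ‖t.v k‖ ≤ t.deltaQ f c k := by
  refine le_trans ?_ h.deltaQ_ge
  have h1 : 0 ≤ (1 / 6 - p.δ) * t.σ k * ‖t.u k‖ ^ 3 := by
    have := h.sigma_pos
    have : 0 < 1 / 6 - p.δ := by linarith [p.δ_lt]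
    positivity
  have h2 := h.beta_mul_l1_ge
  have h3 : p.τ * p.muInit * (K.γA / 2 * ‖t.v k‖) ≤
      p.τ * t.μ k * (t.β k * l1 (c (t.x k))) := by
    have := p.τ_pos
    have := p.muInit_pos
    have := h.mu_pos
    have := h.muInit_le_mu
    have := K.γA_pos
    gcongr
  rw [normalRate]
  linarith

lemma deltaQ_ge_tangential (h : Iter t p K f c X k) :
    (1 / 6 - p.δ) * p.sigmaMin * ‖t.u k‖ ^ 3 ≤ t.deltaQ f c k := by
  refine le_trans ?_ h.deltaQ_ge
  have h1 : 0 ≤ p.τ * t.μ k * (t.β k * l1 (c (t.x k))) := by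
    have := p.τ_pos
    have := h.mu_pos
    have := h.beta_pos
    have := l1_nonneg (c (t.x k))
    positivity
  have h2 : (1 / 6 - p.δ) * p.sigmaMin * ‖t.u k‖ ^ 3 ≤ (1 / 6 - p.δ) * t.σ k * ‖t.u k‖ ^ 3 := by
    have : 0 < 1 / 6 - p.δ := by linarith [p.δ_lt]
    have := h.sigmaMin_le
    gcongr
  linarith

lemma deltaQ_pos (h : Iter t p K f c X k) (hd : t.d k ≠ 0) : 0 < t.deltaQ f c k := by
  by_cases hv : t.v k = 0
  · have hu : t.u k ≠ 0 := fun hu => hd (by rw [Trace.d, hv, hu, add_zero])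
    refine lt_of_lt_of_le ?_ h.deltaQ_ge_tangential
    have := norm_pos_iff.mpr hu
    have := p.sigmaMin_pos
    have : 0 < 1 / 6 - p.δ := by linarith [p.δ_lt]
    positivity
  · refine lt_of_lt_of_le ?_ h.deltaQ_ge_normal
    have := norm_pos_iff.mpr hv
    have := normalRate_pos p K
    positivity

/-- A vanishing trial step occurs only at exact second-order stationary points. -/
lemma isSOSPWith_of_d_eq_zero (h : Iter t p K f c X k) (hd : t.d k = 0) {sg sc sH : ℝ}
    (hsg : 0 ≤ sg) (hsc : 0 ≤ sc) (hsH : 0 ≤ sH) :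
    IsSOSPWith f c sg sc sH (t.x k) (t.lam k) := by
  have hv : ‖t.v k‖ = 0 := le_antisymm
    (h.norm_v_le_norm_d.trans (by rw [hd, norm_zero])) (norm_nonneg _)
  have hu : ‖t.u k‖ = 0 := le_antisymm
    (h.norm_u_le_norm_d.trans (by rw [hd, norm_zero])) (norm_nonneg _)
  refine ⟨?_, ?_, fun z hz => ?_⟩
  · set G := gradient f (t.x k) + jacT c (t.x k) (t.lam k) with hG
    have h1 : jac c (t.x k) G = 0 := by
      have := h.step.dual
      rw [hv, mul_zero] at this
      exact norm_le_zero_iff.mp this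
    have h2 : nullProj c (t.x k) G = 0 := by
      have h3 := h.norm_nullProj_model_gradient_le
      rw [hu, hd, map_zero, add_zero] at h3
      rw [hG, map_add]
      have h4 : nullProj c (t.x k) (jacT c (t.x k) (t.lam k)) = 0 := starProjection_ker_adjoint _ _
      rw [h4, add_zero]
      exact norm_le_zero_iff.mp (by simpa using h3)
    have h5 : nullProj c (t.x k) G = G := by
      rw [nullProj, Submodule.starProjection_eq_self_iff]
      exact LinearMap.mem_ker.mpr h1
    rw [← h5, h2, norm_zero]
    exact hsg
  · have h2 : l1 (c (t.x k)) ≤ 0 := by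
      have h3 := h.l1_le_norm_vc
      have h4 : ‖t.vc k‖ = 0 := by
        have := h.norm_v_eq
        rw [hv] at this
        exact (mul_eq_zero.mp this.symm).resolve_left h.beta_pos.ne'
      rw [h4, mul_zero] at h3
      have h5 : 0 < 1 - p.rv := by linarith [p.rv_lt, p.τ_pos]
      exact nonpos_of_mul_nonpos_right h3 h5
    linarith
  · have h1 := h.neg_mul_sq_le_inner_HTilde z
    have h2 : nullProj c (t.x k) z = z := by
      rw [nullProj, Submodule.starProjection_eq_self_iff]
      exact LinearMap.mem_ker.mpr hz
    have h3 : inner ℝ z (t.HTilde f c k z) = inner ℝ z (hessLag f c (t.x k) (t.lam k) z) := by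
      simp only [Trace.HTilde, ContinuousLinearMap.comp_apply, h2]
      rw [← inner_nullProj, h2]
      rfl
    rw [h3, hu] at h1
    have h4 : 0 ≤ sH * ‖z‖ ^ 2 := by positivity
    linarith

/-! ### Correction steps -/

lemma beta_eq_one (h : Iter t p K f c X k) (hv : ‖t.vc k‖ ≤ p.ζ / √(t.σ k)) : t.β k = 1 := by
  by_cases hc : c (t.x k) = 0
  · exact (h.step.normal.feasible hc).2
  refine le_antisymm h.beta_le_one ?_
  refine le_trans (le_min le_rfl ?_) (h.step.normal.beta_mem hc).1
  have h1 := norm_pos_iff.mpr (h.vc_ne_zero hc)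
  have h2 := h.sqrt_sigma_pos
  rw [le_div_iff₀ h2] at hv
  rw [le_div_iff₀ (by positivity)]
  linarith [p.ζ_lt]

lemma l1_c_add_jac_d_le_cube (h : Iter t p K f c X k) (hv : ‖t.vc k‖ ≤ p.ζ / √(t.σ k)) :
    l1 (c (t.x k) + jac c (t.x k) (t.d k)) ≤ p.rv * ‖t.d k‖ ^ 3 := by
  have h1 : t.vc k = t.v k := by rw [Trace.v, h.beta_eq_one hv, one_smul]
  rw [h.jac_d, h.beta_eq_one hv, one_smul, add_comm]
  refine h.step.normal.residual.trans (mul_le_mul_of_nonneg_left ?_ p.rv_nonneg)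
  refine (min_le_right _ _).trans ?_
  rw [h1]
  gcongr
  exact h.norm_v_le_norm_d

lemma l1_c_trial_le (h : Iter t p K f c X k) :
    l1 (c (t.x k + t.d k)) ≤
      l1 (c (t.x k) + jac c (t.x k) (t.d k)) + K.jacLip * ‖t.d k‖ ^ 2 := by
  have h1 := h.ass.l1_c_sub_jac_le h.x_mem h.trial_mem
  have h2 := l1_add_le (c (t.x k) + jac c (t.x k) (t.d k))
    (c (t.x k + t.d k) - c (t.x k) - jac c (t.x k) (t.d k))
  have e : c (t.x k) + jac c (t.x k) (t.d k) +
    (c (t.x k + t.d k) - c (t.x k) - jac c (t.x k) (t.d k)) = c (t.x k + t.d k) := by abel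
  rw [e] at h2
  linarith

lemma norm_d_cube_le (h : Iter t p K f c X k) : ‖t.d k‖ ^ 3 ≤ stepBound p K * ‖t.d k‖ ^ 2 := by
  have := mul_le_mul_of_nonneg_right h.norm_d_le_div (sq_nonneg ‖t.d k‖)
  rw [stepBound]
  linarith

lemma norm_w_le (h : Iter t p K f c X k) (hw : t.Corrects p f c k) :
    ‖t.w k‖ ≤ corrBound p K * ‖t.d k‖ ^ 2 := by
  obtain ⟨h1, h2⟩ := h.step.correction hw
  have h3 := h.norm_jac_ge h1
  have h4 := (norm_le_l1 _).trans h.l1_c_trial_le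
  have h5 := h.l1_c_add_jac_d_le_cube hw.2
  have h6 := norm_sub_le (jac c (t.x k) (t.w k) + c (t.x k + t.d k)) (c (t.x k + t.d k))
  rw [add_sub_cancel_right] at h6
  have h7 := mul_le_mul_of_nonneg_left h.norm_d_cube_le p.rv_nonneg
  have h8 := mul_le_mul_of_nonneg_left h.norm_d_cube_le p.rw_nonneg
  rw [corrBound, div_mul_eq_mul_div, le_div_iff₀' K.γA_pos]
  linarith

lemma norm_w_le_norm_d (h : Iter t p K f c X k) (hw : t.Corrects p f c k) :
    ‖t.w k‖ ≤ corrBound p K * stepBound p K * ‖t.d k‖ := by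
  refine (h.norm_w_le hw).trans ?_
  have := mul_le_mul_of_nonneg_left h.norm_d_le_div
    (mul_nonneg (corrBound_nonneg p K) (norm_nonneg (t.d k)))
  rw [stepBound]
  linarith

lemma norm_d_add_w_le (h : Iter t p K f c X k) (hw : t.Corrects p f c k) :
    ‖t.d k + t.w k‖ ≤ corrStepBound p K * ‖t.d k‖ := by
  have h1 := h.norm_w_le_norm_d hw
  have h2 := norm_add_le (t.d k) (t.w k)
  rw [corrStepBound]
  linarith

lemma norm_d_mul_norm_w_le (h : Iter t p K f c X k) (hw : t.Corrects p f c k) :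
    ‖t.d k‖ * ‖t.w k‖ ≤ corrBound p K * ‖t.d k‖ ^ 3 := by
  have := mul_le_mul_of_nonneg_left (h.norm_w_le hw) (norm_nonneg (t.d k))
  linarith

lemma norm_w_sq_le (h : Iter t p K f c X k) (hw : t.Corrects p f c k) :
    ‖t.w k‖ ^ 2 ≤ corrBound p K ^ 2 * stepBound p K * ‖t.d k‖ ^ 3 := by
  have h1 := mul_le_mul (h.norm_w_le hw) (h.norm_w_le_norm_d hw) (norm_nonneg _)
    (mul_nonneg (corrBound_nonneg p K) (sq_nonneg _))
  linarith

/-- After a correction the constraint violation is of third order: this is what the correction is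
for. -/
lemma l1_c_corrected_le (h : Iter t p K f c X k) (hw : t.Corrects p f c k) :
    l1 (c (t.x k + t.d k + t.w k)) ≤ corrConBound p K * ‖t.d k‖ ^ 3 := by
  have h1 := h.ass.l1_c_sub_jac_le h.trial_mem (h.corrected_mem hw)
  have h2 := h.ass.l1_jac_sub_le h.trial_mem h.x_mem (t.w k)
  rw [add_sub_cancel_left] at h2
  have h3 := (l1_le_card_mul_norm _).trans
    (mul_le_mul_of_nonneg_left (h.step.correction hw).2 (Nat.cast_nonneg m))
  have e : c (t.x k + t.d k + t.w k) =
      (c (t.x k + t.d k + t.w k) - c (t.x k + t.d k) - jac c (t.x k + t.d k) (t.w k)) +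
      ((jac c (t.x k + t.d k) (t.w k) - jac c (t.x k) (t.w k)) +
        (jac c (t.x k) (t.w k) + c (t.x k + t.d k))) := by abel
  rw [e]
  refine (l1_add_le _ _).trans ?_
  have h4 := l1_add_le (jac c (t.x k + t.d k) (t.w k) - jac c (t.x k) (t.w k))
    (jac c (t.x k) (t.w k) + c (t.x k + t.d k))
  have h5 := mul_le_mul_of_nonneg_left (h.norm_d_mul_norm_w_le hw) K.jacLip_nonneg
  have h6 := mul_le_mul_of_nonneg_left (h.norm_w_sq_le hw) K.jacLip_nonneg
  rw [corrConBound]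
  linarith

lemma inner_gradLag_w_le (h : Iter t p K f c X k) (hw : t.Corrects p f c k) :
    inner ℝ (gradient f (t.x k)) (t.w k) + inner ℝ (t.lam k) (jac c (t.x k) (t.w k)) ≤
      p.rl * corrBound p K / K.γA * ‖t.d k‖ ^ 3 := by
  obtain ⟨⟨z, hz⟩, -⟩ := h.step.correction hw
  have hz' : jacT c (t.x k) z = t.w k := hz
  have e : inner ℝ (gradient f (t.x k)) (t.w k) + inner ℝ (t.lam k) (jac c (t.x k) (t.w k)) =
      inner ℝ (jac c (t.x k) (gradient f (t.x k) + jacT c (t.x k) (t.lam k))) z := by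
    rw [← ContinuousLinearMap.adjoint_inner_right, ← jacT, hz', inner_add_left]
    congr 1
    rw [jacT, ContinuousLinearMap.adjoint_inner_left]
  have h1 : ‖z‖ ≤ ‖t.w k‖ / K.γA := by
    rw [le_div_iff₀' K.γA_pos, ← hz']
    exact h.ass.licq _ h.x_mem z
  have hγ := K.γA_pos
  have hrl := p.rl_nonneg
  rw [e]
  calc _ ≤ ‖jac c (t.x k) (gradient f (t.x k) + jacT c (t.x k) (t.lam k))‖ * ‖z‖ :=
        real_inner_le_norm _ _
    _ ≤ (p.rl * ‖t.d k‖) * (‖t.w k‖ / K.γA) := by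
        gcongr
        refine h.step.dual.trans ?_
        gcongr
        exact h.norm_v_le_norm_d
    _ = p.rl / K.γA * (‖t.d k‖ * ‖t.w k‖) := by ring
    _ ≤ p.rl / K.γA * (corrBound p K * ‖t.d k‖ ^ 3) :=
        mul_le_mul_of_nonneg_left (h.norm_d_mul_norm_w_le hw) (by positivity)
    _ = _ := by ring

/-- At a corrected trial point the quadratic model, whose Hessian is that of the Lagrangian, agrees
with the objective up to third order: the correction brings in the curvature of the constraints. -/
lemma f_corrected_le (h : Iter t p K f c X k) (hw : t.Corrects p f c k) :
    f (t.x k + t.d k + t.w k) ≤ f (t.x k) + inner ℝ (gradient f (t.x k)) (t.d k)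
      + 1 / 2 * inner ℝ (t.d k) (t.H f c k (t.d k)) + corrObjBound p K * ‖t.d k‖ ^ 3 := by
  have hmem := h.corrected_mem hw
  rw [add_assoc] at hmem
  have h1 := h.ass.f_add_le h.x_mem hmem h.norm_lam_le
  rw [← add_assoc] at h1
  have e1 : inner ℝ (t.d k + t.w k) (hessLag f c (t.x k) (t.lam k) (t.d k + t.w k)) =
      inner ℝ (t.d k) (t.H f c k (t.d k)) + 2 * inner ℝ (t.d k) (t.H f c k (t.w k))
        + inner ℝ (t.w k) (t.H f c k (t.w k)) := by
    change inner ℝ (t.d k + t.w k) (t.H f c k (t.d k + t.w k)) = _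
    rw [map_add, inner_add_right, inner_add_left, inner_add_left, ← h.H_symm (t.w k) (t.d k),
      real_inner_comm (t.d k) (t.H f c k (t.w k))]
    ring
  have e2 : inner ℝ (t.lam k) (c (t.x k) + jac c (t.x k) (t.d k + t.w k)) =
      inner ℝ (t.lam k) (c (t.x k) + jac c (t.x k) (t.d k)) +
        inner ℝ (t.lam k) (jac c (t.x k) (t.w k)) := by
    rw [map_add, ← add_assoc, inner_add_right]
  rw [e1, e2, inner_add_right] at h1
  have hH := hBound_nonneg p K
  have h2 : inner ℝ (t.d k) (t.H f c k (t.w k)) ≤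
      hBound p K * corrBound p K * ‖t.d k‖ ^ 3 := by
    refine (le_of_abs_le (h.abs_inner_H_le _ _)).trans ?_
    have := mul_le_mul_of_nonneg_left (h.norm_d_mul_norm_w_le hw) hH
    linarith
  have h3 : 1 / 2 * inner ℝ (t.w k) (t.H f c k (t.w k)) ≤
      hBound p K * corrBound p K ^ 2 * stepBound p K * ‖t.d k‖ ^ 3 := by
    have h4 := le_of_abs_le (h.abs_inner_H_le (t.w k) (t.w k))
    have h5 := mul_le_mul_of_nonneg_left (h.norm_w_sq_le hw) hH
    have h6 : 0 ≤ hBound p K * ‖t.w k‖ ^ 2 := by positivity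
    linarith
  have h4 : inner ℝ (t.lam k) (c (t.x k) + jac c (t.x k) (t.d k)) ≤
      lamBound p K * p.rv * ‖t.d k‖ ^ 3 := by
    rw [mul_assoc]
    exact (real_inner_le_norm _ _).trans (mul_le_mul h.norm_lam_le
      ((norm_le_l1 _).trans (h.l1_c_add_jac_d_le_cube hw.2)) (norm_nonneg _) (NNReal.coe_nonneg _))
  have h5 := h.inner_gradLag_w_le hw
  have h6 := mul_le_mul_of_nonneg_left (h.l1_c_corrected_le hw) (lamBound p K).2
  have h7 : K.hessLip (lamBound p K) * ‖t.d k + t.w k‖ ^ 3 ≤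
      K.hessLip (lamBound p K) * corrStepBound p K ^ 3 * ‖t.d k‖ ^ 3 := by
    rw [mul_assoc, ← mul_pow]
    gcongr
    exact h.norm_d_add_w_le hw
  simp only [NNReal.val_eq_coe] at h6
  rw [corrObjBound]
  linarith

lemma merit_corrected_le (h : Iter t p K f c X k) (hw : t.Corrects p f c k)
    (hμ : t.μ k ≤ muBound p K)
    (hσ : 3 * (corrObjBound p K + muBound p K * corrConBound p K) ≤ t.σ k) :
    merit f c (t.x k + t.d k + t.w k) (t.μ k) ≤ t.q f c k (t.d k) := by
  have h1 := h.f_corrected_le hw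
  have h2 : t.μ k * l1 (c (t.x k + t.d k + t.w k)) ≤
      muBound p K * (corrConBound p K * ‖t.d k‖ ^ 3) :=
    mul_le_mul hμ (h.l1_c_corrected_le hw) (l1_nonneg _) (muBound_pos p K).le
  have h3 := mul_nonneg h.mu_pos.le (l1_nonneg (c (t.x k) + jac c (t.x k) (t.d k)))
  have h4 := mul_le_mul_of_nonneg_right hσ (pow_nonneg (norm_nonneg (t.d k)) 3)
  rw [merit, Trace.q]
  linarith

lemma merit_trial_le (h : Iter t p K f c X k) (hμ : t.μ k ≤ muBound p K) :
    merit f c (t.x k + t.d k) (t.μ k) ≤ t.q f c k (t.d k) + trialBound p K * ‖t.d k‖ ^ 2 := by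
  have h1 := h.ass.f_add_le_linear h.x_mem h.trial_mem
  have h2 := mul_le_mul_of_nonneg_left h.l1_c_trial_le h.mu_pos.le
  have h3 := neg_le_of_abs_le (h.abs_inner_H_le (t.d k) (t.d k))
  have h4 : 0 ≤ t.σ k / 3 * ‖t.d k‖ ^ 3 := by
    have := h.sigma_pos
    positivity
  have h5 : t.μ k * (K.jacLip * ‖t.d k‖ ^ 2) ≤ muBound p K * (K.jacLip * ‖t.d k‖ ^ 2) :=
    mul_le_mul_of_nonneg_right hμ (mul_nonneg K.jacLip_nonneg (sq_nonneg _))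
  rw [merit, Trace.q, trialBound]
  linarith

lemma norm_v_ge (h : Iter t p K f c X k) (hv : ¬ ‖t.vc k‖ ≤ p.ζ / √(t.σ k)) :
    p.ζ / √(t.σ k) ≤ ‖t.v k‖ := by
  have hs := h.sqrt_sigma_pos
  have h0 : 0 < p.ζ / √(t.σ k) := div_pos p.ζ_pos hs
  have h1 : 0 < ‖t.vc k‖ := h0.trans (not_le.mp hv)
  have hc : c (t.x k) ≠ 0 := fun hc => by
    rw [(h.step.normal.feasible hc).1, norm_zero] at h1
    exact h1.false
  rw [h.norm_v_eq]
  rcases min_le_iff.mp (h.step.normal.beta_mem hc).1 with h2 | h2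
  · nlinarith [not_le.mp hv]
  · calc p.ζ / √(t.σ k) ≤ p.θ / √(t.σ k) := by gcongr; exact p.ζ_lt.le
      _ = p.θ / (‖t.vc k‖ * √(t.σ k)) * ‖t.vc k‖ := by field_simp
      _ ≤ _ := by gcongr

/-- When the normal step is long, the predicted reduction is of the order of `‖d‖` and dominates the
second-order model error. -/
lemma eta_le_rho (h : Iter t p K f c X k) (hd : t.d k ≠ 0) (hμ : t.μ k ≤ muBound p K)
    (hv : ¬ ‖t.vc k‖ ≤ p.ζ / √(t.σ k))
    (hσ : (trialBound p K * dBound p K ^ 2 / ((1 - p.η₁) * normalRate p K * p.ζ)) ^ 2 ≤ t.σ k) :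
    p.η₁ ≤ t.rho f c k := by
  have hη : 0 < 1 - p.η₁ := by linarith [p.η₁_lt, p.η₂_lt]
  have hr := normalRate_pos p K
  have hζ := p.ζ_pos
  have hs := h.sqrt_sigma_pos
  have hT := trialBound_nonneg p K
  rw [Trace.rho, le_div_iff₀ (h.deltaQ_pos hd), merit_eq_q_zero]
  have h1 := h.merit_trial_le hμ
  have h2 : trialBound p K * ‖t.d k‖ ^ 2 ≤ (1 - p.η₁) * t.deltaQ f c k := by
    have h3 := Real.le_sqrt_of_sq_le hσ
    rw [div_le_iff₀ (by positivity)] at h3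
    have h4 : trialBound p K * ‖t.d k‖ ^ 2 ≤
        (1 - p.η₁) * (normalRate p K * (p.ζ / √(t.σ k))) := by
      refine le_of_mul_le_mul_right ?_ h.sigma_pos
      have e : (1 - p.η₁) * (normalRate p K * (p.ζ / √(t.σ k))) * t.σ k =
          √(t.σ k) * ((1 - p.η₁) * normalRate p K * p.ζ) := by
        nth_rewrite 2 [← Real.sq_sqrt h.sigma_pos.le]
        field_simp
      rw [e]
      have := mul_le_mul_of_nonneg_left h.sigma_mul_norm_d_sq_le hT
      linarith
    refine h4.trans (mul_le_mul_of_nonneg_left ?_ hη.le)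
    exact (mul_le_mul_of_nonneg_left (h.norm_v_ge hv) hr.le).trans h.deltaQ_ge_normal
  rw [Trace.deltaQ] at h2 ⊢
  linarith

lemma successful_of_sigma_ge (h : Iter t p K f c X k) (hd : t.d k ≠ 0)
    (hμ : t.μ k ≤ muBound p K) (hσ : sigmaSuccess p K ≤ t.σ k) : t.Successful p f c k := by
  have h1 : 0 ≤ 3 * (corrObjBound p K + muBound p K * corrConBound p K) := by
    have := corrObjBound_nonneg p K
    have := corrConBound_nonneg p K
    have := muBound_pos p K
    positivity
  have h2 := sq_nonneg (trialBound p K * dBound p K ^ 2 / ((1 - p.η₁) * normalRate p K * p.ζ))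
  rw [sigmaSuccess] at hσ
  rw [Trace.Successful, Trace.ratio]
  split_ifs with hw
  · have h3 := h.merit_corrected_le hw hμ (by linarith)
    rw [Trace.rhoCorr, le_div_iff₀ (h.deltaQ_pos hd), merit_eq_q_zero]
    have h4 : p.η₁ * t.deltaQ f c k ≤ 1 * t.deltaQ f c k :=
      mul_le_mul_of_nonneg_right (by linarith [p.η₁_lt, p.η₂_lt]) (h.deltaQ_pos hd).le
    rw [Trace.deltaQ] at h4 ⊢
    linarith
  · by_contra hlt
    by_cases hv : ‖t.vc k‖ ≤ p.ζ / √(t.σ k)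
    · exact hw ⟨not_le.mp hlt, hv⟩
    · exact hlt (h.eta_le_rho hd hμ hv (by linarith))

end Iter

/-! ### Decrease at successful iterations -/

section Bounds

variable {m : ℕ} (p : Params) (K : Consts m) (s : ℝ)

/-- A lower bound for the scaling of the normal step while the regularization parameter is at most
`s`. -/
noncomputable def betaBound : ℝ := min 1 (p.θ / ((vBound K + 1) * √s))

/-- The coefficient of `‖v‖` in the bound for the constraint violation at the next iterate. -/
noncomputable def nextConNormal : ℝ := K.jacBound / (betaBound p K s * (1 - p.rv))

/-- The coefficient of `‖d‖²` in the bound for the constraint violation at the next iterate. -/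
noncomputable def nextConStep : ℝ := K.jacLip + corrConBound p K * stepBound p K

/-- The coefficient of `‖d‖²` in the bound for the projected gradient of the Lagrangian at the next
iterate. -/
noncomputable def nextGradStep : ℝ :=
  K.hessLip (lamBound p K) * corrStepBound p K ^ 2 + (2 * s + hBound p K * corrBound p K)
    + K.jacLip * corrStepBound p K / K.γA *
      ((p.rl + K.jacBound * (hBound p K * corrStepBound p K)) / K.γA)

/-- The constant of the bound for the gradient of the Lagrangian at the next iterate in terms of
`‖v‖ + ‖u‖²`. -/
noncomputable def nextGradBound : ℝ :=
  (nextGradStep p K s + 2 * p.rl / K.γA ^ 2 * nextConStep p K) * (vBound K + 1)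
    + 2 * p.rl / K.γA ^ 2 * nextConNormal p K s + 1

/-- The rate of decrease of the merit function at successful iterations. -/
noncomputable def decreaseRate : ℝ :=
  min (p.τ * p.muInit * betaBound p K s)
    (min (normalRate p K / (2 * nextGradBound p K s))
      ((1 / 6 - p.δ) * p.sigmaMin * (1 / (2 * nextGradBound p K s)) ^ (3 / 2 : ℝ)))

variable {s}

lemma betaBound_pos (hs : 0 < s) : 0 < betaBound p K s := by
  have := vBound_nonneg K
  have := Real.sqrt_pos.mpr hs
  have := p.θ_pos
  exact lt_min one_pos (by positivity)

lemma nextConNormal_nonneg (hs : 0 < s) : 0 ≤ nextConNormal p K s := by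
  have := betaBound_pos p K hs
  have := K.jacBound_nonneg
  have : 0 < 1 - p.rv := by linarith [p.rv_lt, p.τ_pos]
  unfold nextConNormal
  positivity

lemma nextConStep_nonneg : 0 ≤ nextConStep p K := by
  have := K.jacLip_nonneg
  have := corrConBound_nonneg p K
  have := stepBound_pos p K
  unfold nextConStep
  positivity

lemma nextGradStep_nonneg (hs : 0 < s) : 0 ≤ nextGradStep p K s := by
  have := K.jacLip_nonneg
  have := K.jacBound_nonneg
  have := K.γA_pos
  have := p.rl_nonneg
  have := hBound_nonneg p K
  have := corrBound_nonneg p K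
  have := corrStepBound_pos p K
  unfold nextGradStep
  positivity

lemma one_le_nextGradBound (hs : 0 < s) : 1 ≤ nextGradBound p K s := by
  have := nextGradStep_nonneg p K hs
  have := nextConStep_nonneg p K
  have := nextConNormal_nonneg p K hs
  have := vBound_nonneg K
  have := p.rl_nonneg
  have := K.γA_pos
  unfold nextGradBound
  refine le_add_of_nonneg_left ?_
  positivity

lemma decreaseRate_pos (hs : 0 < s) : 0 < decreaseRate p K s := by
  have h1 := one_le_nextGradBound p K hs
  have h2 := betaBound_pos p K hs
  have h3 := normalRate_pos p K
  have h4 := p.τ_pos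
  have h5 := p.muInit_pos
  have h6 := p.sigmaMin_pos
  have h7 : 0 < 1 / 6 - p.δ := by linarith [p.δ_lt]
  have h8 : 0 < nextGradBound p K s := by linarith
  exact lt_min (by positivity) (lt_min (by positivity) (by positivity))

end Bounds

namespace Iter

variable {n m : ℕ} {t : Trace n m} {p : Params} {K : Consts m} {f : Vec n → ℝ}
  {c : Vec n → Vec m} {X : Set (Vec n)} {k : ℕ} {s : ℝ}

lemma betaBound_le (h : Iter t p K f c X k) (hσ : t.σ k ≤ s) : betaBound p K s ≤ t.β k := by
  by_cases hc : c (t.x k) = 0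
  · rw [(h.step.normal.feasible hc).2]
    exact min_le_left _ _
  · refine le_trans (min_le_min_left _ ?_) (h.step.normal.beta_mem hc).1
    have h1 := norm_pos_iff.mpr (h.vc_ne_zero hc)
    have h2 := h.sqrt_sigma_pos
    have h3 := h.norm_vc_le_vBound
    have h4 := p.θ_pos
    have h5 := vBound_nonneg K
    gcongr
    linarith

lemma deltaQ_ge_l1 (h : Iter t p K f c X k) (hσ : t.σ k ≤ s) :
    p.τ * p.muInit * betaBound p K s * l1 (c (t.x k)) ≤ t.deltaQ f c k := by
  refine le_trans ?_ h.deltaQ_ge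
  have h1 : 0 ≤ (1 / 6 - p.δ) * t.σ k * ‖t.u k‖ ^ 3 := by
    have := h.sigma_pos
    have : 0 < 1 / 6 - p.δ := by linarith [p.δ_lt]
    positivity
  have h2 : p.τ * p.muInit * (betaBound p K s * l1 (c (t.x k))) ≤
      p.τ * t.μ k * (t.β k * l1 (c (t.x k))) := by
    have := p.τ_pos
    have := p.muInit_pos
    have := h.mu_pos
    have := h.muInit_le_mu
    have := h.betaBound_le hσ
    have := betaBound_pos p K (h.sigma_pos.trans_le hσ)
    have := l1_nonneg (c (t.x k))
    gcongr
  linarith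

lemma l1_le_norm_v (h : Iter t p K f c X k) (hσ : t.σ k ≤ s) :
    l1 (c (t.x k)) ≤ nextConNormal p K s * ‖t.v k‖ := by
  have h0 : 0 < 1 - p.rv := by linarith [p.rv_lt, p.τ_pos]
  have h1 := betaBound_pos p K (h.sigma_pos.trans_le hσ)
  rw [nextConNormal, div_mul_eq_mul_div, le_div_iff₀ (by positivity), h.norm_v_eq]
  calc l1 (c (t.x k)) * (betaBound p K s * (1 - p.rv))
      = betaBound p K s * ((1 - p.rv) * l1 (c (t.x k))) := by ring
    _ ≤ t.β k * (K.jacBound * ‖t.vc k‖) := by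
        have h2 := l1_nonneg (c (t.x k))
        exact mul_le_mul (h.betaBound_le hσ) h.l1_le_norm_vc (by positivity) h.beta_pos.le
    _ = _ := by ring

/-- The next iterate after a success, as a displacement of the current one. -/
lemma next_eq (h : Iter t p K f c X k) (hsucc : t.Successful p f c k) :
    ∃ e : Vec n, t.x (k + 1) = t.x k + (t.d k + e) ∧ ‖e‖ ≤ corrBound p K * ‖t.d k‖ ^ 2 ∧
      ‖t.d k + e‖ ≤ corrStepBound p K * ‖t.d k‖ := by
  have h1 := h.step.x_update
  rw [if_pos hsucc] at h1
  by_cases hw : t.Corrects p f c k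
  · rw [if_pos hw, add_assoc] at h1
    exact ⟨t.w k, h1, h.norm_w_le hw, h.norm_d_add_w_le hw⟩
  · rw [if_neg hw] at h1
    have h2 := corrBound_nonneg p K
    refine ⟨0, by rw [h1, add_zero], by rw [norm_zero]; positivity, ?_⟩
    rw [add_zero, corrStepBound]
    have := stepBound_pos p K
    exact le_mul_of_one_le_left (norm_nonneg _) (le_add_of_nonneg_right (by positivity))

lemma l1_c_next_le (h : Iter t p K f c X k) (hσ : t.σ k ≤ s) (hsucc : t.Successful p f c k) :
    l1 (c (t.x (k + 1))) ≤ nextConNormal p K s * ‖t.v k‖ + nextConStep p K * ‖t.d k‖ ^ 2 := by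
  have h1 := h.step.x_update
  rw [if_pos hsucc] at h1
  have hJ := mul_nonneg K.jacLip_nonneg (sq_nonneg ‖t.d k‖)
  have hC := corrConBound_nonneg p K
  rw [nextConStep]
  by_cases hw : t.Corrects p f c k
  · rw [if_pos hw] at h1
    rw [h1]
    have h2 := h.l1_c_corrected_le hw
    have h3 := mul_le_mul_of_nonneg_left h.norm_d_cube_le hC
    have h4 := mul_nonneg (nextConNormal_nonneg p K (h.sigma_pos.trans_le hσ))
      (norm_nonneg (t.v k))
    linarith
  · rw [if_neg hw] at h1
    rw [h1]
    have h2 := h.l1_c_trial_le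
    have h3 := h.l1_c_add_jac_d_le
    have h4 := h.l1_le_norm_v hσ
    have h5 : 0 ≤ t.β k * (1 - p.rv) * l1 (c (t.x k)) := by
      have := h.beta_pos
      have := l1_nonneg (c (t.x k))
      have : 0 < 1 - p.rv := by linarith [p.rv_lt, p.τ_pos]
      positivity
    have h6 : 0 ≤ corrConBound p K * stepBound p K * ‖t.d k‖ ^ 2 := by
      have := stepBound_pos p K
      positivity
    linarith

/-- Only the normal part of the gradient of the Lagrangian depends on the multiplier, and it is
controlled by the normal step; the projected part may be evaluated with any multiplier `y`. -/
lemma norm_gradLag_le (h : Iter t p K f c X k) (y : Vec m) :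
    ‖gradient f (t.x k) + jacT c (t.x k) (t.lam k)‖ ≤
      ‖nullProj c (t.x k) (gradient f (t.x k) + jacT c (t.x k) y)‖ +
        2 * p.rl / K.γA ^ 2 * l1 (c (t.x k)) := by
  set G := gradient f (t.x k) + jacT c (t.x k) (t.lam k) with hG
  have hP : ∀ z : Vec m, nullProj c (t.x k) (gradient f (t.x k) + jacT c (t.x k) z) =
      nullProj c (t.x k) (gradient f (t.x k)) := fun z => by
    have : nullProj c (t.x k) (jacT c (t.x k) z) = 0 := starProjection_ker_adjoint _ _
    rw [map_add, this, add_zero]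
  have h1 : ‖G - nullProj c (t.x k) G‖ ≤ ‖jac c (t.x k) G‖ / K.γA :=
    norm_sub_starProjection_ker_le K.γA_pos (h.ass.licq _ h.x_mem) G
  have h2 : G = nullProj c (t.x k) G + (G - nullProj c (t.x k) G) := by abel
  have h3 : ‖jac c (t.x k) G‖ / K.γA ≤ 2 * p.rl / K.γA ^ 2 * l1 (c (t.x k)) := by
    have hγ := K.γA_pos
    have hrl := p.rl_nonneg
    have h4 : ‖t.v k‖ ≤ 2 * l1 (c (t.x k)) / K.γA := by
      rw [le_div_iff₀' hγ]
      exact (mul_le_mul_of_nonneg_left h.norm_v_le_norm_vc hγ.le).trans h.norm_vc_le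
    calc ‖jac c (t.x k) G‖ / K.γA ≤ p.rl * (2 * l1 (c (t.x k)) / K.γA) / K.γA := by
          gcongr
          exact h.step.dual.trans (mul_le_mul_of_nonneg_left h4 hrl)
      _ = _ := by field_simp
  calc ‖G‖ ≤ ‖nullProj c (t.x k) G‖ + ‖G - nullProj c (t.x k) G‖ := by
        nth_rewrite 1 [h2]
        exact norm_add_le _ _
    _ ≤ _ := by
        rw [hP y, ← hP (t.lam k)]
        exact add_le_add_right (h1.trans h3) _

lemma norm_nullProj_next_le (h : Iter t p K f c X k) (h' : Iter t p K f c X (k + 1))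
    (hσ : t.σ k ≤ s) (hsucc : t.Successful p f c k) :
    ‖nullProj c (t.x (k + 1))
        (gradient f (t.x (k + 1)) + jacT c (t.x (k + 1)) (t.lam k))‖ ≤
      nextGradStep p K s * ‖t.d k‖ ^ 2 := by
  obtain ⟨e, hx, he, hde⟩ := h.next_eq hsucc
  have hmem := h'.x_mem
  rw [hx] at hmem ⊢
  set y := t.d k + e with hy
  set D := ‖t.d k‖
  have hD : 0 ≤ D := norm_nonneg _
  set z := gradient f (t.x k) + jacT c (t.x k) (t.lam k) + t.H f c k y with hz
  set z' := gradient f (t.x k + y) + jacT c (t.x k + y) (t.lam k) with hz'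
  have hγ := K.γA_pos
  have hH := hBound_nonneg p K
  have hJ := K.jacBound_nonneg
  have hcs := corrStepBound_pos p K
  have hrl := p.rl_nonneg
  have hLip := K.jacLip_nonneg
  have h1 : ‖z' - z‖ ≤ K.hessLip (lamBound p K) * corrStepBound p K ^ 2 * D ^ 2 := by
    have h2 := h.ass.norm_gradLag_sub_le h.x_mem hmem h.norm_lam_le
    have e1 : z' - z = z' - (gradient f (t.x k) + jacT c (t.x k) (t.lam k)) -
        hessLag f c (t.x k) (t.lam k) y := by
      rw [hz, ← sub_sub]
      rfl
    rw [e1, mul_assoc, ← mul_pow]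
    refine h2.trans ?_
    gcongr
  have h2 : ‖nullProj c (t.x k) z‖ ≤ (2 * s + hBound p K * corrBound p K) * D ^ 2 := by
    have h3 : nullProj c (t.x k) (jacT c (t.x k) (t.lam k)) = 0 := starProjection_ker_adjoint _ _
    have h4 : nullProj c (t.x k) z =
        nullProj c (t.x k) (gradient f (t.x k) + t.H f c k (t.d k)) +
          nullProj c (t.x k) (t.H f c k e) := by
      rw [hz, hy, map_add (t.H f c k), map_add, map_add, map_add, map_add, h3, add_zero, add_assoc]
    rw [h4]
    refine (norm_add_le _ _).trans ?_
    have h5 : 2 * t.σ k * ‖t.u k‖ ^ 2 ≤ 2 * s * D ^ 2 := by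
      have := h.norm_u_le_norm_d
      have := h.sigma_pos.trans_le hσ
      gcongr
    have h6 : ‖nullProj c (t.x k) (t.H f c k e)‖ ≤ hBound p K * (corrBound p K * D ^ 2) :=
      (norm_nullProj_le _ _ _).trans ((h.norm_H_apply_le e).trans
        (mul_le_mul_of_nonneg_left he hH))
    have h7 := h.norm_nullProj_model_gradient_le
    linarith
  have h3 : ‖z - nullProj c (t.x k) z‖ ≤
      (p.rl + K.jacBound * (hBound p K * corrStepBound p K)) / K.γA * D := by
    refine (norm_sub_starProjection_ker_le hγ (h.ass.licq _ h.x_mem) z).trans ?_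
    rw [div_mul_eq_mul_div]
    change ‖jac c (t.x k) z‖ / K.γA ≤ _
    gcongr
    rw [hz, map_add]
    refine (norm_add_le _ _).trans ?_
    have h4 : p.rl * ‖t.v k‖ ≤ p.rl * D := by
      have := h.norm_v_le_norm_d
      gcongr
    have h5 : ‖jac c (t.x k) (t.H f c k y)‖ ≤
        K.jacBound * (hBound p K * (corrStepBound p K * D)) := by
      refine (h.ass.norm_jac_le h.x_mem _).trans (mul_le_mul_of_nonneg_left ?_ hJ)
      exact (h.norm_H_apply_le y).trans (mul_le_mul_of_nonneg_left hde hH)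
    have h6 := h.step.dual
    linarith
  have h4 : ‖jac c (t.x k) - jac c (t.x k + y)‖ ≤ K.jacLip * (corrStepBound p K * D) := by
    refine (h.ass.norm_jac_sub_le h.x_mem hmem).trans ?_
    gcongr
    rw [sub_add_cancel_left, norm_neg]
    exact hde
  have h5 := norm_starProjection_ker_le hγ (h.ass.licq _ h.x_mem) h4 z
  change ‖nullProj c (t.x k + y) z‖ ≤ ‖nullProj c (t.x k) z‖ +
    K.jacLip * (corrStepBound p K * D) / K.γA * ‖z - nullProj c (t.x k) z‖ at h5
  have h6 : K.jacLip * (corrStepBound p K * D) / K.γA * ‖z - nullProj c (t.x k) z‖ ≤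
      K.jacLip * (corrStepBound p K * D) / K.γA *
        ((p.rl + K.jacBound * (hBound p K * corrStepBound p K)) / K.γA * D) := by gcongr
  have h7 : ‖nullProj c (t.x k + y) z'‖ ≤ ‖z' - z‖ + ‖nullProj c (t.x k + y) z‖ := by
    have : nullProj c (t.x k + y) z' =
        nullProj c (t.x k + y) (z' - z) + nullProj c (t.x k + y) z := by
      rw [← map_add, sub_add_cancel]
    rw [this]
    exact (norm_add_le _ _).trans (add_le_add_left (norm_nullProj_le _ _ _) _)
  have e2 : K.jacLip * (corrStepBound p K * D) / K.γA *
        ((p.rl + K.jacBound * (hBound p K * corrStepBound p K)) / K.γA * D) =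
      K.jacLip * corrStepBound p K / K.γA *
        ((p.rl + K.jacBound * (hBound p K * corrStepBound p K)) / K.γA) * D ^ 2 := by ring
  rw [nextGradStep]
  linarith

/-- After a success the gradient of the Lagrangian is of first order in the normal step and of
second order in the tangential step. -/
lemma norm_gradLag_next_le (h : Iter t p K f c X k) (h' : Iter t p K f c X (k + 1))
    (hσ : t.σ k ≤ s) (hsucc : t.Successful p f c k) :
    ‖gradient f (t.x (k + 1)) + jacT c (t.x (k + 1)) (t.lam (k + 1))‖ ≤
      nextGradBound p K s * (‖t.v k‖ + ‖t.u k‖ ^ 2) := by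
  have hs := h.sigma_pos.trans_le hσ
  have h1 := h'.norm_gradLag_le (t.lam k)
  have h2 := h.norm_nullProj_next_le h' hσ hsucc
  have hr : 0 ≤ 2 * p.rl / K.γA ^ 2 := by
    have := p.rl_nonneg
    have := K.γA_pos
    positivity
  have h3 := mul_le_mul_of_nonneg_left (h.l1_c_next_le hσ hsucc) hr
  have h4 : ‖t.d k‖ ^ 2 ≤ (vBound K + 1) * (‖t.v k‖ + ‖t.u k‖ ^ 2) := by
    rw [h.norm_d_sq]
    have h5 := mul_le_mul_of_nonneg_right h.norm_v_le_vBound (norm_nonneg (t.v k))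
    have h6 := mul_nonneg (vBound_nonneg K) (sq_nonneg ‖t.u k‖)
    have h7 := norm_nonneg (t.v k)
    linarith
  have h5 := mul_le_mul_of_nonneg_left h4 (add_nonneg (nextGradStep_nonneg p K hs)
    (mul_nonneg hr (nextConStep_nonneg p K)))
  have h6 := mul_nonneg (mul_nonneg hr (nextConNormal_nonneg p K hs)) (sq_nonneg ‖t.u k‖)
  have h7 := norm_nonneg (t.v k)
  have h8 := sq_nonneg ‖t.u k‖
  rw [nextGradBound]
  linarith

lemma decrease_of_infeasible (h : Iter t p K f c X k) (hσ : t.σ k ≤ s) {ε : ℝ} (hε : 0 ≤ ε)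
    (hc : ε ≤ l1 (c (t.x k))) : decreaseRate p K s * ε ≤ t.deltaQ f c k := by
  refine le_trans ?_ (h.deltaQ_ge_l1 hσ)
  have h1 := (decreaseRate_pos p K (h.sigma_pos.trans_le hσ)).le.trans (min_le_left _ _)
  exact mul_le_mul (min_le_left _ _) hc hε h1

lemma decrease_of_next_gradient (h : Iter t p K f c X k) (h' : Iter t p K f c X (k + 1))
    (hσ : t.σ k ≤ s) (hsucc : t.Successful p f c k) {ε : ℝ} (hε : 0 ≤ ε) (hε1 : ε ≤ 1)
    (hg : ε ≤ ‖gradient f (t.x (k + 1)) + jacT c (t.x (k + 1)) (t.lam (k + 1))‖) :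
    decreaseRate p K s * ε ^ (3 / 2 : ℝ) ≤ t.deltaQ f c k := by
  have hs := h.sigma_pos.trans_le hσ
  have hB : 0 < nextGradBound p K s := zero_lt_one.trans_le (one_le_nextGradBound p K hs)
  have h1 := hg.trans (h.norm_gradLag_next_le h' hσ hsucc)
  have hpow : 0 ≤ ε ^ (3 / 2 : ℝ) := Real.rpow_nonneg hε _
  set B := nextGradBound p K s
  rcases le_total (ε / (2 * B)) ‖t.v k‖ with hv | hv
  · have h2 : ε ^ (3 / 2 : ℝ) ≤ ε := Real.rpow_le_self_of_le_one hε hε1 (by norm_num)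
    have hr := normalRate_pos p K
    calc decreaseRate p K s * ε ^ (3 / 2 : ℝ) ≤ normalRate p K / (2 * B) * ε :=
          mul_le_mul ((min_le_right _ _).trans (min_le_left _ _)) h2 hpow (by positivity)
      _ = normalRate p K * (ε / (2 * B)) := by ring
      _ ≤ normalRate p K * ‖t.v k‖ := by gcongr
      _ ≤ _ := h.deltaQ_ge_normal
  · have h2 : 1 / (2 * B) * ε ≤ ‖t.u k‖ ^ 2 := by
      rw [div_mul_eq_mul_div, one_mul, div_le_iff₀ (by positivity)]
      rw [le_div_iff₀ (by positivity)] at hv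
      linarith
    have h3 : (1 / (2 * B)) ^ (3 / 2 : ℝ) * ε ^ (3 / 2 : ℝ) ≤ ‖t.u k‖ ^ 3 := by
      rw [← Real.mul_rpow (by positivity) hε]
      refine (Real.rpow_le_rpow (by positivity) h2 (by norm_num)).trans_eq ?_
      rw [← Real.rpow_natCast, ← Real.rpow_natCast, ← Real.rpow_mul (norm_nonneg _)]
      norm_num
    have hδ : 0 < 1 / 6 - p.δ := by linarith [p.δ_lt]
    have hm := p.sigmaMin_pos
    calc decreaseRate p K s * ε ^ (3 / 2 : ℝ)
        ≤ (1 / 6 - p.δ) * p.sigmaMin * (1 / (2 * B)) ^ (3 / 2 : ℝ) * ε ^ (3 / 2 : ℝ) :=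
          mul_le_mul_of_nonneg_right ((min_le_right _ _).trans (min_le_right _ _)) hpow
      _ = (1 / 6 - p.δ) * p.sigmaMin * ((1 / (2 * B)) ^ (3 / 2 : ℝ) * ε ^ (3 / 2 : ℝ)) := by ring
      _ ≤ (1 / 6 - p.δ) * p.sigmaMin * ‖t.u k‖ ^ 3 := by gcongr
      _ ≤ _ := h.deltaQ_ge_tangential

end Iter

/-! ### Parameter bounds along a run -/

/-- Iterations with a regularization parameter above this threshold are successful. The second
summand makes the bound `γ₂ σ*` so large that the logarithmic terms in the count of all iterations
are absorbed. -/
noncomputable def sigmaThreshold {m : ℕ} (p : Params) (K : Consts m) : ℝ :=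
  sigmaSuccess p K + 2 * -Real.log p.γ₃ * p.sigma0 / p.γ₂ + 1

/-- A bound for the regularization parameters along a run. -/
noncomputable def sigmaBound {m : ℕ} (p : Params) (K : Consts m) : ℝ :=
  max p.sigma0 (p.γ₂ * sigmaThreshold p K)

section Bounds

variable {m : ℕ} (p : Params) (K : Consts m)

lemma sigma0_pos : 0 < p.sigma0 := p.sigmaMin_pos.trans_le p.sigmaMin_le

lemma one_lt_gamma2 : 1 < p.γ₂ := p.γ₁_gt.trans p.γ₁_lt

lemma neg_log_gamma3_nonneg : 0 ≤ -Real.log p.γ₃ :=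
  neg_nonneg.mpr (Real.log_nonpos p.γ₃_pos.le p.γ₃_le)

lemma sigmaSuccess_nonneg : 0 ≤ sigmaSuccess p K := by
  have := corrObjBound_nonneg p K
  have := corrConBound_nonneg p K
  have := muBound_pos p K
  unfold sigmaSuccess
  positivity

lemma sigmaThreshold_extra_nonneg : 0 ≤ 2 * -Real.log p.γ₃ * p.sigma0 / p.γ₂ := by
  have := neg_log_gamma3_nonneg p
  have := sigma0_pos p
  have : 0 < p.γ₂ := zero_lt_one.trans (one_lt_gamma2 p)
  positivity

lemma sigmaSuccess_le_sigmaThreshold : sigmaSuccess p K ≤ sigmaThreshold p K := by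
  have := sigmaThreshold_extra_nonneg p
  rw [sigmaThreshold]
  linarith

lemma sigmaThreshold_pos : 0 < sigmaThreshold p K := by
  have := sigmaSuccess_nonneg p K
  have := sigmaThreshold_extra_nonneg p
  rw [sigmaThreshold]
  linarith

lemma sigmaBound_pos : 0 < sigmaBound p K := (sigma0_pos p).trans_le (le_max_left _ _)

lemma log_sigmaBound_le :
    Real.log (sigmaBound p K / p.sigma0) - Real.log p.γ₃ ≤ sigmaBound p K / p.sigma0 := by
  have h0 := sigma0_pos p
  have h1 := sigmaBound_pos p K
  have h2 : 0 < p.γ₂ := zero_lt_one.trans (one_lt_gamma2 p)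
  have hy : 0 < sigmaBound p K / p.sigma0 := by positivity
  have h3 : 2 * -Real.log p.γ₃ ≤ sigmaBound p K / p.sigma0 := by
    rw [le_div_iff₀ h0]
    refine le_trans ?_ (le_max_right _ _)
    have h4 : 2 * -Real.log p.γ₃ * p.sigma0 / p.γ₂ ≤ sigmaThreshold p K := by
      have := sigmaSuccess_nonneg p K
      rw [sigmaThreshold]
      linarith
    rwa [div_le_iff₀' h2] at h4
  have h4 := Real.log_le_sub_one_of_pos (half_pos hy)
  rw [Real.log_div hy.ne' two_ne_zero] at h4
  have h5 := Real.log_two_lt_d9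
  linarith

end Bounds

lemma natCast_lt_of_succ_le {N : ℕ∞} {k : ℕ} (hk : ((k + 1 : ℕ) : ℕ∞) ≤ N) : (k : ℕ∞) < N :=
  (Nat.cast_lt.mpr k.lt_succ_self).trans_le hk

/-- An execution of the algorithm under the standing assumptions. -/
structure Run {n m : ℕ} (t : Trace n m) (p : Params) (K : Consts m) (f : Vec n → ℝ)
    (c : Vec n → Vec m) (X : Set (Vec n)) (sg sc sH : ℝ) : Prop where
  ass : Assumptions K f c X
  isRun : t.IsRun p f c sg sc sH
  staysIn : t.StaysIn p f c X
  sg_nonneg : 0 ≤ sg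
  sc_nonneg : 0 ≤ sc
  sH_nonneg : 0 ≤ sH

namespace Run

variable {n m : ℕ} {t : Trace n m} {p : Params} {K : Consts m} {f : Vec n → ℝ}
  {c : Vec n → Vec m} {X : Set (Vec n)} {sg sc sH : ℝ}

lemma iter_of_bounds (h : Run t p K f c X sg sc sH) {k : ℕ} (hk : (k : ℕ∞) < t.N)
    (hσ : p.sigmaMin ≤ t.σ k) (hμ : p.muInit ≤ t.prevMu p k) : Iter t p K f c X k where
  ass := h.ass
  step := h.isRun.step k hk
  sigmaMin_le := hσ
  muInit_le := hμ
  x_mem := h.staysIn.iterate k hk.le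
  trial_mem := h.staysIn.trial k hk
  corrected_mem := h.staysIn.corrected k hk

lemma d_ne_zero (h : Run t p K f c X sg sc sH) {k : ℕ} (hk : (k : ℕ∞) < t.N)
    (hi : Iter t p K f c X k) : t.d k ≠ 0 := fun hd =>
  h.isRun.continues k hk
    ⟨_, hi.isSOSPWith_of_d_eq_zero hd h.sg_nonneg h.sc_nonneg h.sH_nonneg⟩

/-- The regularization parameter increases only below the threshold, hence never by more than the
factor `γ₂` beyond it; the merit parameter is bounded because the trial merit parameter is. -/
lemma bounds (h : Run t p K f c X sg sc sH) (k : ℕ) (hk : (k : ℕ∞) ≤ t.N) :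
    p.sigmaMin ≤ t.σ k ∧ t.σ k ≤ sigmaBound p K ∧ p.muInit ≤ t.prevMu p k ∧
      t.prevMu p k ≤ muBound p K := by
  induction k with
  | zero =>
    rw [h.isRun.sigma_init, Trace.prevMu, if_pos rfl]
    exact ⟨p.sigmaMin_le, le_max_left _ _, le_rfl, muInit_le_muBound p K⟩
  | succ k ih =>
    have hk' := natCast_lt_of_succ_le hk
    obtain ⟨h1, h2, h3, h4⟩ := ih hk'.le
    have hi := h.iter_of_bounds hk' h1 h3
    have hμ := hi.mu_le_muBound h4
    have hs := hi.step
    have hpos := hi.sigma_pos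
    have hprev : t.prevMu p (k + 1) = t.μ k := by simp [Trace.prevMu]
    rw [hprev]
    refine ⟨?_, ?_, hi.muInit_le_mu, hμ⟩
    · rcases lt_or_ge (t.ratio p f c k) p.η₁ with hr | hr
      · have := (hs.sigma_unsuccessful hr).1
        nlinarith [p.γ₁_gt]
      · rcases lt_or_ge p.η₂ (t.ratio p f c k) with hr' | hr'
        · exact (le_max_left _ _).trans (hs.sigma_very_successful hr').1
        · rwa [hs.sigma_successful hr hr']
    · rcases lt_or_ge (t.ratio p f c k) p.η₁ with hr | hr
      · have h5 : t.σ k < sigmaThreshold p K := by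
          by_contra! hge
          exact hr.not_ge (hi.successful_of_sigma_ge (h.d_ne_zero hk' hi) hμ
            ((sigmaSuccess_le_sigmaThreshold p K).trans hge))
        refine (hs.sigma_unsuccessful hr).2.trans (le_trans ?_ (le_max_right _ _))
        exact mul_le_mul_of_nonneg_left h5.le (zero_lt_one.trans (one_lt_gamma2 p)).le
      · rcases lt_or_ge p.η₂ (t.ratio p f c k) with hr' | hr'
        · exact (hs.sigma_very_successful hr').2.trans h2
        · rwa [hs.sigma_successful hr hr']

lemma iter (h : Run t p K f c X sg sc sH) {k : ℕ} (hk : (k : ℕ∞) < t.N) : Iter t p K f c X k :=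
  h.iter_of_bounds hk (h.bounds k hk.le).1 (h.bounds k hk.le).2.2.1

lemma mu_le (h : Run t p K f c X sg sc sH) {k : ℕ} (hk : (k : ℕ∞) < t.N) :
    t.μ k ≤ muBound p K :=
  (h.iter hk).mu_le_muBound (h.bounds k hk.le).2.2.2

end Run

/-! ### Counting iterations -/

/-- The number of successful iterations before iteration `k`. -/
noncomputable def succCount {n m : ℕ} (t : Trace n m) (p : Params) (f : Vec n → ℝ)
    (c : Vec n → Vec m) (k : ℕ) : ℕ := {j : ℕ | j < k ∧ t.Successful p f c j}.ncard

section Count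

variable {n m : ℕ} (t : Trace n m) (p : Params) (f : Vec n → ℝ) (c : Vec n → Vec m)

lemma succCount_zero : succCount t p f c 0 = 0 := by simp [succCount]

variable {t p f c} {k : ℕ}

lemma succCount_succ_of_successful (h : t.Successful p f c k) :
    succCount t p f c (k + 1) = succCount t p f c k + 1 := by
  have e : {j : ℕ | j < k + 1 ∧ t.Successful p f c j} =
      insert k {j : ℕ | j < k ∧ t.Successful p f c j} := by
    ext j
    simp only [Set.mem_ofPred_eq, Set.mem_insert_iff]
    grind
  rw [succCount, e, Set.ncard_insert_of_notMem (by simp)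
    ((Set.finite_lt_nat k).subset fun j hj => hj.1), succCount]

lemma succCount_succ_of_not_successful (h : ¬ t.Successful p f c k) :
    succCount t p f c (k + 1) = succCount t p f c k := by
  rw [succCount, succCount]
  congr 1
  ext j
  simp only [Set.mem_ofPred_eq]
  grind

end Count

/-- The constant that is used for each of `α₁`, `α₂`, `α₃`. Half of the decrease at an infeasible
iterate is set aside for the preceding iteration. -/
noncomputable def accountRate {m : ℕ} (p : Params) (K : Consts m) : ℝ :=
  min (decreaseRate p K (sigmaBound p K) / 2) (muBound p K)

lemma accountRate_pos {m : ℕ} (p : Params) (K : Consts m) : 0 < accountRate p K :=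
  lt_min (half_pos (decreaseRate_pos p K (sigmaBound_pos p K))) (muBound_pos p K)

open Classical in
/-- The indicator of constraint violation beyond `ε`. -/
noncomputable def infeasible {n m : ℕ} (c : Vec n → Vec m) (ε : ℝ) (x : Vec n) : ℝ :=
  if ε < l1 (c x) then 1 else 0

/-- The upper bound for the merit decrease before iteration `k`, arranged such that it does not
decrease when the merit parameter is raised. -/
noncomputable def meritGap {n m : ℕ} (t : Trace n m) (p : Params) (K : Consts m) (f : Vec n → ℝ)
    (c : Vec n → Vec m) (k : ℕ) : ℝ :=
  f (t.x 0) - f (t.x k) + t.prevMu p k * (K.conBound - l1 (c (t.x k)))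

lemma infeasible_nonneg {n m : ℕ} (c : Vec n → Vec m) (ε : ℝ) (x : Vec n) :
    0 ≤ infeasible c ε x := by
  unfold infeasible
  split_ifs <;> norm_num

lemma kappaT_nonneg {m : ℕ} {p : Params} {K : Consts m} {f0 flow : ℝ} (hf : flow ≤ f0) :
    0 ≤ kappaT K p f0 flow (muBound p K) (accountRate p K) (accountRate p K) (accountRate p K) := by
  have h1 := mul_nonneg (mul_nonneg zero_le_two K.conBound_nonneg) (muBound_pos p K).le
  rw [kappaT, min_self, min_self]
  refine div_nonneg ?_ (mul_nonneg p.η₁_pos.le (accountRate_pos p K).le)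
  rw [Consts.conBound] at h1
  linarith

lemma one_le_min_mul_max {εg εc : ℝ} (hεg : 0 < εg) (hεc : 0 < εc) :
    1 ≤ min (εg ^ (3 / 2 : ℝ)) εc * max (εg ^ (-(3 / 2) : ℝ)) (εc ^ (-1 : ℝ)) := by
  have h0 := Real.rpow_pos_of_pos hεg (3 / 2)
  rw [Real.rpow_neg hεg.le, Real.rpow_neg_one]
  rcases min_choice (εg ^ (3 / 2 : ℝ)) εc with h | h
  · rw [h, ← mul_inv_cancel₀ h0.ne']
    exact mul_le_mul_of_nonneg_left (le_max_left _ _) h0.le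
  · rw [h]
    nth_rewrite 1 [← mul_inv_cancel₀ hεc.ne']
    exact mul_le_mul_of_nonneg_left (le_max_right _ _) hεc.le

namespace Run

variable {n m : ℕ} {t : Trace n m} {p : Params} {K : Consts m} {f : Vec n → ℝ}
  {c : Vec n → Vec m} {X : Set (Vec n)} {sg sc sH εg εc : ℝ} {k : ℕ}

lemma merit_decrease (h : Run t p K f c X sg sc sH) (hk : (k : ℕ∞) < t.N)
    (hs : t.Successful p f c k) :
    p.η₁ * t.deltaQ f c k ≤
      merit f c (t.x k) (t.μ k) - merit f c (t.x (k + 1)) (t.μ k) := by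
  have hi := h.iter hk
  have hq := hi.deltaQ_pos (h.d_ne_zero hk hi)
  have h1 := hi.step.x_update
  have h2 := hs
  rw [if_pos hs] at h1
  rw [Trace.Successful, Trace.ratio] at h2
  rw [h1]
  split_ifs at h2 ⊢ with hw
  · rwa [Trace.rhoCorr, le_div_iff₀ hq] at h2
  · rwa [Trace.rho, le_div_iff₀ hq] at h2

lemma meritGap_add_le (h : Run t p K f c X sg sc sH) (hk : (k : ℕ∞) < t.N) :
    meritGap t p K f c k + (merit f c (t.x k) (t.μ k) - merit f c (t.x (k + 1)) (t.μ k)) ≤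
      meritGap t p K f c (k + 1) := by
  have hi := h.iter hk
  have h1 := mul_nonneg (sub_nonneg.mpr hi.prevMu_le_mu)
    (sub_nonneg.mpr (h.ass.l1_c_le hi.x_mem))
  have hprev : t.prevMu p (k + 1) = t.μ k := by simp [Trace.prevMu]
  rw [meritGap, meritGap, merit, merit, hprev]
  linarith

/-- Each successful iteration is paid for by the merit decrease and the change of the indicator of
infeasibility. A success at an infeasible iterate decreases the merit function by twice the rate;
one that leads to an infeasible iterate is paid for by the indicator; any other one leads to an
iterate with a large gradient of the Lagrangian. -/
lemma account_step (h : Run t p K f c X sg sc sH) (hk : ((k + 1 : ℕ) : ℕ∞) < t.N)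
    (hs : t.Successful p f c k) (hεg : 0 < εg) (hεg1 : εg < 1) (hεc : 0 < εc)
    (hfail : l1 (c (t.x (k + 1))) ≤ εc →
      εg < ‖gradient f (t.x (k + 1)) + jacT c (t.x (k + 1)) (t.lam (k + 1))‖) :
    p.η₁ * accountRate p K * min (εg ^ (3 / 2 : ℝ)) εc ≤
      merit f c (t.x k) (t.μ k) - merit f c (t.x (k + 1)) (t.μ k)
        + p.η₁ * accountRate p K * min (εg ^ (3 / 2 : ℝ)) εc *
          (infeasible c εc (t.x (k + 1)) - infeasible c εc (t.x k)) := by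
  have hk0 := natCast_lt_of_succ_le hk.le
  have hi := h.iter hk0
  have hi' := h.iter hk
  have hσ := (h.bounds k hk0.le).2.1
  have hm := h.merit_decrease hk0 hs
  have hη := p.η₁_pos
  have hq := (hi.deltaQ_pos (h.d_ne_zero hk0 hi)).le
  have hr := decreaseRate_pos p K (sigmaBound_pos p K)
  have ha := accountRate_pos p K
  have ha' : accountRate p K ≤ decreaseRate p K (sigmaBound p K) / 2 := min_le_left _ _
  have he : 0 < min (εg ^ (3 / 2 : ℝ)) εc := lt_min (Real.rpow_pos_of_pos hεg _) hεc
  set e := min (εg ^ (3 / 2 : ℝ)) εc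
  have hB : 0 < p.η₁ * accountRate p K * e := by positivity
  have hae : 2 * (accountRate p K * e) ≤ decreaseRate p K (sigmaBound p K) * e := by
    have := mul_le_mul_of_nonneg_right ha' he.le
    linarith
  by_cases h1 : εc < l1 (c (t.x k))
  · have h2 : infeasible c εc (t.x k) = 1 := if_pos h1
    have h3 := hi.decrease_of_infeasible hσ hεc.le h1.le
    have h4 : decreaseRate p K (sigmaBound p K) * e ≤ decreaseRate p K (sigmaBound p K) * εc :=
      mul_le_mul_of_nonneg_left (min_le_right _ _) hr.le
    have h5 := mul_le_mul_of_nonneg_left (hae.trans (h4.trans h3)) hη.le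
    have h6 := mul_nonneg hB.le (infeasible_nonneg c εc (t.x (k + 1)))
    rw [h2]
    linarith
  · have h2 : infeasible c εc (t.x k) = 0 := if_neg h1
    rw [h2, sub_zero]
    by_cases h3 : εc < l1 (c (t.x (k + 1)))
    · have h4 : infeasible c εc (t.x (k + 1)) = 1 := if_pos h3
      have h5 := mul_nonneg hη.le hq
      rw [h4]
      linarith
    · have h4 := hi.decrease_of_next_gradient hi' hσ hs hεg.le hεg1.le
        (hfail (not_lt.mp h3)).le
      have h5 : decreaseRate p K (sigmaBound p K) * e ≤
          decreaseRate p K (sigmaBound p K) * εg ^ (3 / 2 : ℝ) :=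
        mul_le_mul_of_nonneg_left (min_le_left _ _) hr.le
      have h6 := mul_le_mul_of_nonneg_left (hae.trans (h5.trans h4)) hη.le
      have h7 := mul_nonneg hB.le (infeasible_nonneg c εc (t.x (k + 1)))
      linarith

lemma account (h : Run t p K f c X sg sc sH) (hεg : 0 < εg) (hεg1 : εg < 1) (hεc : 0 < εc)
    (hk : (k : ℕ∞) < t.N)
    (hfail : ∀ j ≤ k, l1 (c (t.x j)) ≤ εc →
      εg < ‖gradient f (t.x j) + jacT c (t.x j) (t.lam j)‖) :
    p.η₁ * accountRate p K * min (εg ^ (3 / 2 : ℝ)) εc * succCount t p f c k ≤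
      meritGap t p K f c k +
        p.η₁ * accountRate p K * min (εg ^ (3 / 2 : ℝ)) εc * infeasible c εc (t.x k) := by
  have hB : 0 < p.η₁ * accountRate p K * min (εg ^ (3 / 2 : ℝ)) εc :=
    mul_pos (mul_pos p.η₁_pos (accountRate_pos p K))
      (lt_min (Real.rpow_pos_of_pos hεg _) hεc)
  induction k with
  | zero =>
    have h1 := mul_nonneg hB.le (infeasible_nonneg c εc (t.x 0))
    have h2 : 0 ≤ meritGap t p K f c 0 := by
      have h3 := mul_nonneg (p.muInit_pos.le.trans (h.iter hk).muInit_le)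
        (sub_nonneg.mpr (h.ass.l1_c_le (h.iter hk).x_mem))
      rw [meritGap]
      linarith
    rw [succCount_zero, Nat.cast_zero, mul_zero]
    linarith
  | succ k ih =>
    have hk0 := natCast_lt_of_succ_le hk.le
    have ih := ih hk0 fun j hj => hfail j (hj.trans k.le_succ)
    have h1 := h.meritGap_add_le hk0
    by_cases hs : t.Successful p f c k
    · have h2 := h.account_step hk hs hεg hεg1 hεc (hfail (k + 1) le_rfl)
      rw [succCount_succ_of_successful hs]
      push_cast
      linarith
    · have h2 : t.x (k + 1) = t.x k := by
        have := (h.iter hk0).step.x_update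
        rwa [if_neg hs] at this
      rw [h2, sub_self] at h1
      rw [succCount_succ_of_not_successful hs, h2]
      linarith

/-- The infeasibility of the last iterate is paid for by the second half of the term
`2 κ_c μ_max`. -/
lemma account_total (h : Run t p K f c X sg sc sH) (hεg : 0 < εg) (hεg1 : εg < 1)
    (hεc : 0 < εc) (hk : (k : ℕ∞) < t.N)
    (hfail : ∀ j ≤ k, l1 (c (t.x j)) ≤ εc →
      εg < ‖gradient f (t.x j) + jacT c (t.x j) (t.lam j)‖) :
    p.η₁ * accountRate p K * min (εg ^ (3 / 2 : ℝ)) εc * succCount t p f c k ≤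
      f (t.x 0) - f (t.x k) + 2 * K.conBound * muBound p K := by
  have h1 := h.account hεg hεg1 hεc hk hfail
  have hi := h.iter hk
  have hl := h.ass.l1_c_le hi.x_mem
  have hl0 := l1_nonneg (c (t.x k))
  have h2 : t.prevMu p k * (K.conBound - l1 (c (t.x k))) ≤ muBound p K * K.conBound :=
    mul_le_mul (h.bounds k hk.le).2.2.2 (by linarith) (by linarith) (muBound_pos p K).le
  have h3 : p.η₁ * accountRate p K * min (εg ^ (3 / 2 : ℝ)) εc * infeasible c εc (t.x k) ≤
      muBound p K * K.conBound := by
    have hη := p.η₁_pos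
    have ha := accountRate_pos p K
    have hμ := muBound_pos p K
    by_cases h4 : εc < l1 (c (t.x k))
    · have h5 : infeasible c εc (t.x k) = 1 := if_pos h4
      rw [h5, mul_one]
      refine mul_le_mul ?_ ((min_le_right _ _).trans (h4.le.trans hl))
        (le_min (Real.rpow_nonneg hεg.le _) hεc.le) hμ.le
      calc p.η₁ * accountRate p K ≤ 1 * muBound p K :=
            mul_le_mul (by linarith [p.η₁_lt, p.η₂_lt]) (min_le_right _ _) ha.le zero_le_one
        _ = _ := one_mul _
    · have h5 : infeasible c εc (t.x k) = 0 := if_neg h4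
      rw [h5, mul_zero]
      exact mul_nonneg hμ.le K.conBound_nonneg
  rw [meritGap] at h1
  linarith

lemma succCount_le_of_lower_bound (h : Run t p K f c X sg sc sH) {flow : ℝ} (hεg : 0 < εg)
    (hεg1 : εg < 1) (hεc : 0 < εc) (hk : (k : ℕ∞) < t.N) (hf : flow ≤ f (t.x k))
    (hfail : ∀ j ≤ k, l1 (c (t.x j)) ≤ εc →
      εg < ‖gradient f (t.x j) + jacT c (t.x j) (t.lam j)‖) :
    (succCount t p f c k : ℝ) ≤
      kappaT K p (f (t.x 0)) flow (muBound p K) (accountRate p K) (accountRate p K)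
        (accountRate p K) * max (εg ^ (-(3 / 2) : ℝ)) (εc ^ (-1 : ℝ)) := by
  have h1 := h.account_total hεg hεg1 hεc hk hfail
  have h2 := one_le_min_mul_max hεg hεc
  have hη := p.η₁_pos
  have ha := accountRate_pos p K
  set M := max (εg ^ (-(3 / 2) : ℝ)) (εc ^ (-1 : ℝ))
  set e := min (εg ^ (3 / 2 : ℝ)) εc
  have hM : 0 ≤ M := (Real.rpow_nonneg hεg.le _).trans (le_max_left _ _)
  have h3 : e * succCount t p f c k ≤ kappaT K p (f (t.x 0)) flow (muBound p K)
      (accountRate p K) (accountRate p K) (accountRate p K) := by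
    rw [kappaT, min_self, min_self, le_div_iff₀ (mul_pos hη ha)]
    rw [Consts.conBound] at h1
    linarith
  calc (succCount t p f c k : ℝ) ≤ (e * M) * succCount t p f c k :=
        le_mul_of_one_le_left (Nat.cast_nonneg _) h2
    _ = (e * succCount t p f c k) * M := by ring
    _ ≤ _ := mul_le_mul_of_nonneg_right h3 hM

/-- The objective is only known to be bounded below at the start of a successful iteration, so the
last success is counted separately. -/
lemma succCount_le (h : Run t p K f c X sg sc sH) {flow : ℝ} (hb : t.BoundedBelow p f c flow)
    (hεg : 0 < εg) (hεg1 : εg < 1) (hεc : 0 < εc) (hk : (k : ℕ∞) ≤ t.N)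
    (hfail : ∀ j < k, l1 (c (t.x j)) ≤ εc →
      εg < ‖gradient f (t.x j) + jacT c (t.x j) (t.lam j)‖) :
    (succCount t p f c k : ℝ) ≤
      kappaT K p (f (t.x 0)) flow (muBound p K) (accountRate p K) (accountRate p K)
        (accountRate p K) * max (εg ^ (-(3 / 2) : ℝ)) (εc ^ (-1 : ℝ)) + 1 := by
  induction k with
  | zero =>
    have hM : 0 ≤ max (εg ^ (-(3 / 2) : ℝ)) (εc ^ (-1 : ℝ)) :=
      (Real.rpow_nonneg hεg.le _).trans (le_max_left _ _)
    have := mul_nonneg (kappaT_nonneg (p := p) (K := K) hb.initial) hM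
    rw [succCount_zero, Nat.cast_zero]
    linarith
  | succ k ih =>
    have hk0 := natCast_lt_of_succ_le hk
    by_cases hs : t.Successful p f c k
    · have h1 := h.succCount_le_of_lower_bound hεg hεg1 hεc hk0 (hb.successful k hk0 hs)
        fun j hj => hfail j (Nat.lt_succ_of_le hj)
      rw [succCount_succ_of_successful hs]
      push_cast
      linarith
    · rw [succCount_succ_of_not_successful hs]
      exact ih hk0.le fun j hj => hfail j (hj.trans k.lt_succ_self)

lemma log_sigma_ge (h : Run t p K f c X sg sc sH) (hk : (k : ℕ∞) ≤ t.N) :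
    Real.log p.sigma0 + ((k : ℝ) - succCount t p f c k) * Real.log p.γ₁
      + succCount t p f c k * Real.log p.γ₃ ≤ Real.log (t.σ k) := by
  induction k with
  | zero => simp [succCount_zero, h.isRun.sigma_init]
  | succ k ih =>
    have hk0 := natCast_lt_of_succ_le hk
    have ih := ih hk0.le
    have hi := h.iter hk0
    have hpos := hi.sigma_pos
    by_cases hs : t.Successful p f c k
    · have h1 : p.γ₃ * t.σ k ≤ t.σ (k + 1) := by
        rcases lt_or_ge p.η₂ (t.ratio p f c k) with hr | hr
        · exact (le_max_right _ _).trans (hi.step.sigma_very_successful hr).1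
        · rw [hi.step.sigma_successful hs hr]
          exact mul_le_of_le_one_left hpos.le p.γ₃_le
      have h2 := Real.log_le_log (mul_pos p.γ₃_pos hpos) h1
      rw [Real.log_mul p.γ₃_pos.ne' hpos.ne'] at h2
      rw [succCount_succ_of_successful hs]
      push_cast
      linarith
    · have hγ : 0 < p.γ₁ := zero_lt_one.trans p.γ₁_gt
      have h2 := Real.log_le_log (mul_pos hγ hpos) (hi.step.sigma_unsuccessful (not_le.mp hs)).1
      rw [Real.log_mul hγ.ne' hpos.ne'] at h2
      rw [succCount_succ_of_not_successful hs]
      push_cast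
      linarith

/-- Unsuccessful iterations raise the bounded regularization parameter, so their number is
controlled by that of the successful ones. -/
lemma index_le (h : Run t p K f c X sg sc sH) {flow : ℝ} (hb : t.BoundedBelow p f c flow)
    (hεg : 0 < εg) (hεg1 : εg < 1) (hεc : 0 < εc) (hk : (k : ℕ∞) ≤ t.N)
    (hfail : ∀ j < k, l1 (c (t.x j)) ≤ εc →
      εg < ‖gradient f (t.x j) + jacT c (t.x j) (t.lam j)‖) :
    (k : ℝ) ≤
      kappaTTilde p (kappaT K p (f (t.x 0)) flow (muBound p K) (accountRate p K)
        (accountRate p K) (accountRate p K)) (sigmaBound p K) / Real.log p.γ₁ *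
          max (εg ^ (-(3 / 2) : ℝ)) (εc ^ (-1 : ℝ)) + 1 := by
  have h1 := h.succCount_le hb hεg hεg1 hεc hk hfail
  have h2 := h.log_sigma_ge hk
  have h3 := log_sigmaBound_le p K
  have hσ0 := sigma0_pos p
  have hσb := sigmaBound_pos p K
  obtain ⟨h4, h5, -⟩ := h.bounds k hk
  have h6 := Real.log_le_log (p.sigmaMin_pos.trans_le h4) h5
  have hγ := Real.log_pos p.γ₁_gt
  have hγ3 := neg_log_gamma3_nonneg p
  have hM : 1 ≤ max (εg ^ (-(3 / 2) : ℝ)) (εc ^ (-1 : ℝ)) :=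
    (Real.one_le_rpow_of_pos_of_le_one_of_nonpos hεg hεg1.le (by norm_num)).trans
      (le_max_left _ _)
  rw [Real.log_div hσb.ne' hσ0.ne'] at h3
  set kT := kappaT K p (f (t.x 0)) flow (muBound p K) (accountRate p K) (accountRate p K)
    (accountRate p K)
  set M := max (εg ^ (-(3 / 2) : ℝ)) (εc ^ (-1 : ℝ))
  have h7 := mul_le_mul_of_nonneg_right h1
    (by linarith : 0 ≤ Real.log p.γ₁ - Real.log p.γ₃)
  have h8 : sigmaBound p K / p.sigma0 ≤ sigmaBound p K / p.sigma0 * M :=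
    le_mul_of_one_le_right (by positivity) hM
  refine le_of_mul_le_mul_right ?_ hγ
  have e : (kappaTTilde p kT (sigmaBound p K) / Real.log p.γ₁ * M + 1) * Real.log p.γ₁ =
      kappaTTilde p kT (sigmaBound p K) * M + Real.log p.γ₁ := by field_simp
  rw [e, kappaTTilde]
  linarith

/-- The run reaches an approximate first-order stationary point: it stops at one, or else the bound
on the number of iterations is violated. -/
lemma exists_first_order (h : Run t p K f c X sg sc sH) {flow : ℝ}
    (hb : t.BoundedBelow p f c flow) (hεg : 0 < εg) (hεg1 : εg < 1) (hεc : 0 < εc)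
    (hsg : sg ≤ εg) (hsc : sc ≤ εc) :
    ∃ k : ℕ, (k : ℕ∞) ≤ t.N ∧ l1 (c (t.x k)) ≤ εc ∧
      ‖gradient f (t.x k) + jacT c (t.x k) (t.lam k)‖ ≤ εg := by
  by_contra! hcon
  have hN : t.N = ⊤ := by
    by_contra hN
    obtain ⟨k, hk⟩ := ENat.ne_top_iff_exists.mp hN
    obtain ⟨h1, h2, -⟩ := h.isRun.stops k hk
    exact (hcon k hk.le (h2.trans hsc)).not_ge (h1.trans hsg)
  obtain ⟨k, hk⟩ := exists_nat_gt (kappaTTilde p (kappaT K p (f (t.x 0)) flow (muBound p K)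
    (accountRate p K) (accountRate p K) (accountRate p K)) (sigmaBound p K) / Real.log p.γ₁ *
      max (εg ^ (-(3 / 2) : ℝ)) (εc ^ (-1 : ℝ)) + 1)
  have htop : ∀ j : ℕ, (j : ℕ∞) ≤ t.N := fun j => hN ▸ le_top
  exact hk.not_ge (h.index_le hb hεg hεg1 hεc (htop k) fun j _ => hcon j (htop j))

end Run

end SCP

theorem mainTheorem2 (m : ℕ) (p : SCP.Params) (K : SCP.Consts m) :
    ∃ muMax sigmaStar α₁ α₂ α₃ : ℝ,
      0 < muMax ∧ 0 < sigmaStar ∧ 0 < α₁ ∧ 0 < α₂ ∧ 0 < α₃ ∧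
      ∀ (n : ℕ) (f : SCP.Vec n → ℝ) (c : SCP.Vec n → SCP.Vec m) (X : Set (SCP.Vec n)),
        SCP.Assumptions K f c X →
        ∀ (sg sc sH : ℝ), 0 ≤ sg → 0 ≤ sc → 0 ≤ sH →
        ∀ t : SCP.Trace n m, t.IsRun p f c sg sc sH → t.StaysIn p f c X →
          (∀ k : ℕ, (k : ℕ∞) < t.N →
            t.μ k ≤ muMax ∧ t.σ k ≤ max p.sigma0 (p.γ₂ * sigmaStar)) ∧
          ∀ (flow : ℝ), t.BoundedBelow p f c flow →
          ∀ (εg εc : ℝ), 0 < εg → εg < 1 → 0 < εc → εc < 1 → sg ≤ εg → sc ≤ εc →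
            ∃ k : ℕ, (k : ℕ∞) ≤ t.N ∧
              ‖SCP.gradLag f c (t.x k) (t.lam k)‖ ≤ εg ∧
              SCP.l1 (c (t.x k)) ≤ εc ∧
              (({j : ℕ | j < k ∧ t.Successful p f c j}.ncard : ℕ) : ℤ) ≤
                ⌈SCP.kappaT K p (f (t.x 0)) flow muMax α₁ α₂ α₃ *
                  max (εg ^ (-(3 / 2) : ℝ)) (εc ^ (-1 : ℝ))⌉ + 1 ∧
              (k : ℤ) ≤
                ⌈SCP.kappaTTilde p (SCP.kappaT K p (f (t.x 0)) flow muMax α₁ α₂ α₃)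
                    (max p.sigma0 (p.γ₂ * sigmaStar)) / Real.log p.γ₁ *
                  max (εg ^ (-(3 / 2) : ℝ)) (εc ^ (-1 : ℝ))⌉ + 1 := by
  classical
  refine ⟨SCP.muBound p K, SCP.sigmaThreshold p K, SCP.accountRate p K, SCP.accountRate p K,
    SCP.accountRate p K, SCP.muBound_pos p K, SCP.sigmaThreshold_pos p K, SCP.accountRate_pos p K,
    SCP.accountRate_pos p K, SCP.accountRate_pos p K, ?_⟩
  intro n f c X hass sg sc sH hsg hsc hsH t hrun hstay
  have h : SCP.Run t p K f c X sg sc sH := ⟨hass, hrun, hstay, hsg, hsc, hsH⟩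
  refine ⟨fun k hk => ⟨h.mu_le hk, (h.bounds k hk.le).2.1⟩, ?_⟩
  intro flow hb εg εc hεg hεg1 hεc _ hsgε hscε
  have hex := h.exists_first_order hb hεg hεg1 hεc hsgε hscε
  obtain ⟨hk, hck, hgk⟩ := Nat.find_spec hex
  -- all iterations before the first approximate stationary point fail the test
  have hfail : ∀ j < Nat.find hex, SCP.l1 (c (t.x j)) ≤ εc →
      εg < ‖gradient f (t.x j) + SCP.jacT c (t.x j) (t.lam j)‖ := fun j hj hc => by
    by_contra! hg
    exact Nat.find_min hex hj ⟨(Nat.cast_le.mpr hj.le).trans hk, hc, hg⟩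
  refine ⟨Nat.find hex, hk, ?_, hck, ?_, ?_⟩
  · rw [SCP.gradLag, hass.gradLag_eq (hstay.iterate _ hk)]
    exact hgk
  · have h1 := (h.succCount_le hb hεg hεg1 hεc hk hfail).trans
      (add_le_add_left (Int.le_ceil _) _)
    exact_mod_cast h1
  · have h1 := (h.index_le hb hεg hεg1 hεc hk hfail).trans
      (add_le_add_left (Int.le_ceil _) _)
    exact_mod_cast h1
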